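/- A *map* is a 2-cell embedding of a finite connected graph (loops and multiple edges allowed) in a closed surface, in Tutte's form: a finite nonempty set $X$ on which the Klein group $\{1,\alpha,\beta,\alpha\beta\}$ acts freely, together with a permutation $P$ of $X$ such that $\alpha P=P^{-1}\alpha$, $P^kx\neq\alpha x$ for all $x\in X$, $k\in\mathbb Z$, and $\langle\alpha,\beta,P\rangle$ is transitive on $X$. Vertices correspond to the pairs of conjugate cycles of $P$ (through $x$ and $\alpha x$), the valency of a vertex being the length of these cycles; edges are the sets $\{x,\alpha x,\beta x,\alpha\beta x\}$; faces correspond to the pairs of conjugate cycles of $P\alpha\beta$ (through $x$ and $\beta x$). The map is non-orientable if $\langle\alpha\beta,P\rangle$ is transitive on $X$ and orientable otherwise; it lies on the torus (on the Klein bottle) if it is orientable (non-orientable) with Euler characteristic $0$. Maps are isomorphic if there is a bijection between their sets $X$ commuting with $\alpha,\beta,P$, and they are counted up to isomorphism. A map is *triangular* if all its faces are triangles (all cycles of $P\alpha\beta$ have length $3$), and *loopless* if no edge joins a vertex to itself. A *closed s-manifold* is a connected closed surface obtained from finitely many equilateral triangular disks by identifying their sides in pairs, the two sides of each pair belonging to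 distinct disks, such that every vertex is the identification of one corner of each of five, six or seven distinct disks. Two are isomorphic if there is a bijection between their disks, with matchings of the corners of corresponding disks, that respects the identifications. **Correspondence.** For every $n$, sending a closed s-manifold to the map formed by its vertices, edges and disks induces a bijection from the isomorphism classes of closed s-manifolds with $n$ disks onto the isomorphism classes of loopless triangular maps with $n$ faces and all vertex valencies in $\{5,6,7\}$. **Classification.** For $V\subseteq\{5,6,7\}$ let $\Delta(V)$ be the set of isomorphism classes of triangular maps whose set of vertex valencies is exactly $V$. Then 1. $\Delta(\{5\})=\{O_{20},P_{10}\}$, where $O_{20}$ is the icosahedron (20 triangles), $P_{10}$ is its quotient by the antipodal map (10 triangles, on the projective plane), and $O_{20}\not\cong P_{10}$; 2. $\Delta(\{6\})=\{T_i,K_j: i,j=1,2,3,\dots\}$, where the $T_i$ are infinitely many pairwise non-isomorphic maps on the torus and the $K_j$ are infinitely many pairwise non-isomorphic maps on the Klein bottle; 3. $\Delta(\{7\})=\{H_i: i=1,2,3,\dots\}$ with infinitely many pairwise non-isomorphic $H_i$ (the triangular maps with all valencies $7$, called Hurwitz maps); 4. $|\Delta(\{5,7\})|\ge 2$; 5.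 each of $\Delta(\{5,6\})$, $\Delta(\{6,7\})$, $\Delta(\{5,6,7\})$ is infinite. Items 1 to 5 hold as well (with possibly different $T_i,K_j,H_i$) if only loopless triangular maps are admitted in the definition of $\Delta(V)$, i.e. for the types of closed s-manifolds. -/

import Mathlib

open Equiv

/-! ### Maps on closed surfaces -/

/-- A (finite) map in the sense of Tutte: a basic permutation `P` of a finite nonempty set `X` that
is a disjoint union of quadricells `{x, αx, βx, αβx}`, i.e. on which the Klein four-group
`{1, α, β, αβ}` acts freely, such that `α P = P⁻¹ α` and `⟨α, β, P⟩` is transitive on `X`. -/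
structure TutteMap where
  X : Type
  finite : Finite X
  nonempty : Nonempty X
  α : Perm X
  β : Perm X
  P : Perm X
  α_invol : ∀ x, α (α x) = x
  β_invol : ∀ x, β (β x) = x
  α_β_comm : ∀ x, α (β x) = β (α x)
  α_free : ∀ x, α x ≠ x
  β_free : ∀ x, β x ≠ x
  αβ_free : ∀ x, α (β x) ≠ x
  basic : ∀ (x : X) (k : ℤ), (P ^ k) x ≠ α x
  α_P : α * P = P⁻¹ * α
  transitive : ∀ x y, ∃ g ∈ Subgroup.closure {α, β, P}, g x = y

namespace TutteMap

/-- Isomorphism of maps: a bijection commuting with `α`, `β` and `P`. -/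
def Iso (M N : TutteMap) : Prop :=
  ∃ ξ : M.X ≃ N.X, ∀ x, ξ (M.α x) = N.α (ξ x) ∧ ξ (M.β x) = N.β (ξ x) ∧ ξ (M.P x) = N.P (ξ x)

instance isoSetoid : Setoid TutteMap where
  r := Iso
  iseqv :=
    { refl := fun _ => ⟨Equiv.refl _, fun _ => ⟨rfl, rfl, rfl⟩⟩
      symm := by
        rintro M N ⟨ξ, h⟩
        refine ⟨ξ.symm, fun y => ?_⟩
        obtain ⟨x, rfl⟩ := ξ.surjective y
        obtain ⟨h1, h2, h3⟩ := h x
        rw [← h1, ← h2, ← h3]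
        simp
      trans := by
        rintro L M N ⟨ξ, h⟩ ⟨η, k⟩
        refine ⟨ξ.trans η, fun x => ?_⟩
        obtain ⟨h1, h2, h3⟩ := h x
        obtain ⟨k1, k2, k3⟩ := k (ξ x)
        simp [h1, h2, h3, k1, k2, k3] }

/-- The number of orbits on `X` of the group generated by `S`. -/
noncomputable def orbitCount {X : Type} (S : Set (Perm X)) : ℕ :=
  Nat.card (MulAction.orbitRel.Quotient (Subgroup.closure S) X)

variable (M : TutteMap)

/-- The number of vertices; a vertex is a pair of conjugate orbits of `P`, the orbits of some `x`
and of `αx`. -/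
noncomputable def vertexCount : ℕ := orbitCount {M.P, M.α}

/-- The number of edges; an edge is an orbit of `{1, α, β, αβ}`. -/
noncomputable def edgeCount : ℕ := orbitCount {M.α, M.β}

/-- The number of faces, i.e. of vertices of the dual map, in which `α` and `β` are
interchanged and `P` is replaced by `Pαβ`. -/
noncomputable def faceCount : ℕ := orbitCount {M.P * M.α * M.β, M.β}

/-- The Euler characteristic. -/
noncomputable def eulerChar : ℤ := (M.vertexCount : ℤ) - M.edgeCount + M.faceCount

/-- A map is non-orientable if `⟨αβ, P⟩` is transitive, and orientable otherwise. -/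
def Nonorientable : Prop :=
  ∀ x y, ∃ g ∈ Subgroup.closure {M.α * M.β, M.P}, g x = y

/-- The set of valencies of the vertices: the lengths of the cycles of `P`. -/
def valencies : Set ℕ := Set.range fun x => Function.minimalPeriod M.P x

/-- Every face is a triangle: all cycles of `Pαβ` have length three. -/
def Triangular : Prop := ∀ x, Function.minimalPeriod (M.P * M.α * M.β) x = 3

/-- No edge joins a vertex to itself. -/
def Loopless : Prop := ∀ x, ¬ ∃ g ∈ Subgroup.closure {M.P, M.α}, g x = M.β x

/-- A map on the torus. -/
def OnTorus : Prop := ¬ M.Nonorientable ∧ M.eulerChar = 0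

/-- A map on the Klein bottle. -/
def OnKleinBottle : Prop := M.Nonorientable ∧ M.eulerChar = 0

/-- Isomorphism classes of maps. -/
abbrev Class : Type 1 := Quotient isoSetoid

/-- The isomorphism classes of the maps in a given collection. -/
def classesOf (S : Set TutteMap) : Set Class := (fun M => (⟦M⟧ : Class)) '' S

/-- The isomorphism classes of the triangular maps in the collection `C` whose set of vertex
valencies is exactly `V`. -/
def Delta (C : Set TutteMap) (V : Set ℕ) : Set Class :=
  classesOf {M | M ∈ C ∧ M.Triangular ∧ M.valencies = V}

/-- If the involutions `α` and `Pα` have no fixed points, then `P` is basic. -/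
theorem basic_of_free {X : Type} (a P : Perm X) (hP : a * P = P⁻¹ * a)
    (h1 : ∀ x, a x ≠ x) (h2 : ∀ x, P (a x) ≠ x) (x : X) (k : ℤ) : (P ^ k) x ≠ a x := by
  have hz : ∀ (m : ℤ) (y : X), (P ^ (-m)) (a y) = a ((P ^ m) y) := by
    intro m y
    have : a * P ^ m = P ^ (-m) * a := by
      have h : SemiconjBy a P P⁻¹ := hP
      have := h.zpow_right m
      rw [zpow_neg, ← inv_zpow]
      exact this
    exact (Perm.congr_fun this y).symm
  intro h
  obtain ⟨m, rfl | rfl⟩ := Int.even_or_odd' k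
  · apply h1 ((P ^ m) x)
    rw [← hz, ← h, ← Perm.mul_apply, ← zpow_add]
    congr 2
    ring
  · apply h2 ((P ^ (m + 1)) x)
    rw [← hz, ← h, ← Perm.mul_apply, ← Perm.mul_apply, mul_assoc, ← zpow_add, ← zpow_one_add]
    congr 2
    ring

end TutteMap

/-! ### Closed s-manifolds -/

namespace Glue

/-- The sides, with a direction, of the triangular disks indexed by `F`. The corners of a disk are
labelled by `Fin 3`; the pair `(f, π)` is the side of the disk `f` that runs from the corner `π 0`
to the corner `π 1` (the remaining corner is `π 2`). -/
abbrev Side (F : Type) : Type := F × Perm (Fin 3)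

/-- The same side with the opposite direction. -/
def rev {F : Type} : Perm (Side F) := (Equiv.refl F).prodCongr (Equiv.mulRight (swap 0 1))

/-- The other side of the same disk that starts at the same corner. -/
def turn {F : Type} : Perm (Side F) := (Equiv.refl F).prodCongr (Equiv.mulRight (swap 1 2))

/-- The corner of a disk at which a directed side starts. -/
def start {F : Type} (z : Side F) : F × Fin 3 := (z.1, z.2 0)

/-- The relation on the corners of disks generated by the identification of each directed side `z`
with the directed side `glue z`: two corners are related if they become the same vertex. -/
def SameVertex {F : Type} (glue : Perm (Side F)) : F × Fin 3 → F × Fin 3 → Prop :=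
  Relation.EqvGen fun c d => ∃ z, start z = c ∧ start (glue z) = d

/-- The relation on disks generated by having a common edge. -/
def Linked {F : Type} (glue : Perm (Side F)) : F → F → Prop :=
  Relation.EqvGen fun f g => ∃ z : Side F, z.1 = f ∧ (glue z).1 = g

end Glue

open Glue in
/-- A closed (connected) s-manifold: finitely many triangular disks whose sides are identified in
pairs, the two sides in each pair belonging to distinct disks, such that each vertex is the
identification of one corner in each of five, six or seven distinct disks. -/
structure ClosedSManifold where
  F : Type
  finite : Finite F
  nonempty : Nonempty F
  glue : Perm (Side F)
  glue_invol : ∀ z, glue (glue z) = z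
  glue_rev : ∀ z, glue (rev z) = rev (glue z)
  glue_ne : ∀ z, (glue z).1 ≠ z.1
  vertex_distinct : ∀ f i j, SameVertex glue (f, i) (f, j) → i = j
  vertex_disks : ∀ c, Set.ncard {d | SameVertex glue c d} ∈ ({5, 6, 7} : Set ℕ)
  connected : ∀ f g, Linked glue f g

namespace ClosedSManifold

open Glue

/-- Isomorphism of closed s-manifolds: a bijection of the disks together with, for each disk, a
matching of its corners with those of its image, compatible with the identifications. -/
def Iso (S T : ClosedSManifold) : Prop :=
  ∃ (e : S.F ≃ T.F) (ρ : S.F → Perm (Fin 3)), ∀ z w : Side S.F, S.glue z = w →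
    T.glue (e z.1, ρ z.1 * z.2) = (e w.1, ρ w.1 * w.2)

instance isoSetoid : Setoid ClosedSManifold where
  r := Iso
  iseqv :=
    { refl := fun _ => ⟨Equiv.refl _, fun _ => 1, fun z w h => by simpa using h⟩
      symm := by
        rintro S T ⟨e, ρ, h⟩
        refine ⟨e.symm, fun f => (ρ (e.symm f))⁻¹, ?_⟩
        rintro z w rfl
        have := h (e.symm z.1, (ρ (e.symm z.1))⁻¹ * z.2) _ rfl
        simp only [apply_symm_apply, mul_inv_cancel_left, Prod.mk.eta] at this
        rw [this]
        simp
      trans := by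
        rintro S T U ⟨e, ρ, h⟩ ⟨e', ρ', h'⟩
        refine ⟨e.trans e', fun f => ρ' (e f) * ρ f, ?_⟩
        intro z w hzw
        have := h' _ _ (h z w hzw)
        simpa [mul_assoc] using this }

/-- Isomorphism classes of closed s-manifolds. -/
abbrev Class : Type 1 := Quotient isoSetoid

theorem rev_rev {F : Type} (z : Side F) : rev (rev z) = z := by
  obtain ⟨f, π⟩ := z
  simp [rev, mul_assoc]

theorem turn_turn {F : Type} (z : Side F) : turn (turn z) = z := by
  obtain ⟨f, π⟩ := z
  simp [turn, mul_assoc]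

theorem turn_ne {F : Type} (z : Side F) : turn z ≠ z := by
  intro h
  have h2 := congrArg Prod.snd h
  simp only [turn, prodCongr_apply, Prod.map_snd, coe_mulRight, mul_eq_left] at h2
  exact absurd h2 (by decide)

theorem rev_ne {F : Type} (z : Side F) : rev z ≠ z := by
  intro h
  have h2 := congrArg Prod.snd h
  simp only [rev, prodCongr_apply, Prod.map_snd, coe_mulRight, mul_eq_left] at h2
  exact absurd h2 (by decide)

theorem same_disk {F : Type} (G : Subgroup (Perm (Side F))) (hr : rev ∈ G) (ht : turn ∈ G)
    (f : F) (π τ : Perm (Fin 3)) : ∃ g ∈ G, g (f, π) = (f, τ) := by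
  have key : ∀ σ : Perm (Fin 3), σ = 1 ∨ σ = swap 0 1 ∨ σ = swap 1 2 ∨ σ = swap 0 1 * swap 1 2 ∨
      σ = swap 1 2 * swap 0 1 ∨ σ = swap 0 1 * swap 1 2 * swap 0 1 := by decide
  have hτ : τ = π * (π⁻¹ * τ) := by simp
  rw [hτ]
  rcases key (π⁻¹ * τ) with h | h | h | h | h | h <;> rw [h]
  · exact ⟨1, G.one_mem, by simp⟩
  · exact ⟨rev, hr, rfl⟩
  · exact ⟨turn, ht, rfl⟩
  · exact ⟨turn * rev, G.mul_mem ht hr, rfl⟩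
  · exact ⟨rev * turn, G.mul_mem hr ht, rfl⟩
  · exact ⟨rev * turn * rev, G.mul_mem (G.mul_mem hr ht) hr, rfl⟩

theorem glue_transitive (S : ClosedSManifold) (x y : Side S.F) :
    ∃ g ∈ Subgroup.closure {S.glue, rev, turn * S.glue}, g x = y := by
  set G := Subgroup.closure {S.glue, rev, turn * S.glue} with hG
  have hα : S.glue ∈ G := Subgroup.subset_closure (by simp)
  have hr : rev ∈ G := Subgroup.subset_closure (by simp)
  have ht : turn ∈ G := by
    have : turn * S.glue ∈ G := Subgroup.subset_closure (by simp)
    simpa using G.mul_mem this (G.inv_mem hα)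
  have main : ∀ f g : S.F, Linked S.glue f g →
      ∀ π τ : Perm (Fin 3), ∃ k ∈ G, k (f, π) = (g, τ) := by
    intro f g h
    induction h with
    | rel f g h =>
      obtain ⟨z, rfl, rfl⟩ := h
      intro π τ
      obtain ⟨k1, hk1, e1⟩ := same_disk G hr ht z.1 π z.2
      obtain ⟨k2, hk2, e2⟩ := same_disk G hr ht (S.glue z).1 (S.glue z).2 τ
      exact ⟨k2 * S.glue * k1, G.mul_mem (G.mul_mem hk2 hα) hk1, by simp [e1, e2]⟩
    | refl f => exact same_disk G hr ht f
    | symm f g _ ih =>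
      intro π τ
      obtain ⟨k, hk, e⟩ := ih τ π
      exact ⟨k⁻¹, G.inv_mem hk, by rw [← e]; simp⟩
    | trans f g h _ _ ih1 ih2 =>
      intro π τ
      obtain ⟨k1, hk1, e1⟩ := ih1 π 1
      obtain ⟨k2, hk2, e2⟩ := ih2 1 τ
      exact ⟨k2 * k1, G.mul_mem hk2 hk1, by simp [e1, e2]⟩
  exact main x.1 y.1 (S.connected _ _) x.2 y.2

/-- The map formed by the vertices, edges and disks of a closed s-manifold. Here `α` passes from a
directed side to the directed side of the neighbouring disk with which it is identified, `β`
reverses directed sides, and `P` rotates around the starting vertex. -/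
def toMap (S : ClosedSManifold) : TutteMap where
  X := Side S.F
  finite := by have := S.finite; infer_instance
  nonempty := by have := S.nonempty; infer_instance
  α := S.glue
  β := rev
  P := turn * S.glue
  α_invol := S.glue_invol
  β_invol := rev_rev
  α_β_comm := S.glue_rev
  α_free := fun z h => S.glue_ne z (congrArg Prod.fst h)
  β_free := rev_ne
  αβ_free := fun z h => S.glue_ne z (by
    have h' : rev z = S.glue z := by
      rw [← S.glue_invol (rev z)]
      exact congrArg S.glue h
    rw [← h']
    rfl)
  basic := by
    have ha : S.glue⁻¹ = S.glue := by
      rw [inv_eq_iff_mul_eq_one]; ext1 z; exact S.glue_invol z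
    have ht : (turn : Perm (Side S.F))⁻¹ = turn := by
      rw [inv_eq_iff_mul_eq_one]; ext1 z; exact turn_turn z
    refine TutteMap.basic_of_free _ _ (by simp [mul_assoc, ha, ht])
      (fun z h => S.glue_ne z (congrArg Prod.fst h)) (fun z h => ?_)
    simp only [Perm.mul_apply, S.glue_invol] at h
    exact turn_ne z h
  α_P := by
    have ha : S.glue⁻¹ = S.glue := by
      rw [inv_eq_iff_mul_eq_one]; ext1 z; exact S.glue_invol z
    have ht : (turn : Perm (Side S.F))⁻¹ = turn := by
      rw [inv_eq_iff_mul_eq_one]; ext1 z; exact turn_turn z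
    simp [mul_assoc, ha, ht]
  transitive := S.glue_transitive

theorem toMap_iso {S T : ClosedSManifold} (h : S.Iso T) : S.toMap.Iso T.toMap := by
  obtain ⟨e, ρ, h⟩ := h
  let ξ : Side S.F ≃ Side T.F :=
    { toFun := fun z => (e z.1, ρ z.1 * z.2)
      invFun := fun w => (e.symm w.1, (ρ (e.symm w.1))⁻¹ * w.2)
      left_inv := fun z => by simp
      right_inv := fun w => by simp }
  have hα : ∀ z, ξ (S.glue z) = T.glue (ξ z) := fun z => (h z _ rfl).symm
  have hβ : ∀ z, ξ (rev z) = rev (ξ z) := fun z => by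
    simp [ξ, rev, mul_assoc]
  have hγ : ∀ z, ξ (turn z) = turn (ξ z) := fun z => by
    simp [ξ, turn, mul_assoc]
  refine ⟨ξ, fun z => ⟨hα z, hβ z, ?_⟩⟩
  exact (hγ (S.glue z)).trans (congrArg turn (hα z))

/-- The isomorphism class of maps of an isomorphism class of closed s-manifolds. -/
def classToMap : Class → TutteMap.Class :=
  Quotient.map toMap fun _ _ h => toMap_iso h

end ClosedSManifold

/-! ### The icosahedron and its projective quotient -/

/-- Data for a closed surface triangulated by a simplicial complex: `T a b c` says that `a`, `b`,
`c` are the vertices of a triangle, and `op a b c` is the third vertex of the second triangle on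
the edge `ab` of the triangle `abc`. -/
structure TriComplex where
  V : Type
  finite : Finite V
  T : V → V → V → Bool
  op : V → V → V → V
  swap12 : ∀ a b c, T a b c → T b a c
  swap23 : ∀ a b c, T a b c → T a c b
  ne12 : ∀ a b c, T a b c → a ≠ b
  ne23 : ∀ a b c, T a b c → b ≠ c
  op_mem : ∀ a b c, T a b c → T a b (op a b c)
  op_ne : ∀ a b c, T a b c → op a b c ≠ c
  op_op : ∀ a b c, T a b c → op a b (op a b c) = c
  op_comm : ∀ a b c, T a b c → op a b c = op b a c

namespace TriComplex

variable (K : TriComplex)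

/-- Flags: `(a, b, c)` stands for the vertex `a`, the edge `ab` and the triangle `abc`. -/
def Flag : Type := {t : K.V × K.V × K.V // K.T t.1 t.2.1 t.2.2}

/-- Change the triangle of a flag. -/
def flipFace : Perm K.Flag :=
  Function.Involutive.toPerm
    (fun t => ⟨(t.1.1, t.1.2.1, K.op t.1.1 t.1.2.1 t.1.2.2), K.op_mem _ _ _ t.2⟩)
    (fun t => Subtype.ext (by simp [K.op_op _ _ _ t.2]))

/-- Change the vertex of a flag. -/
def flipVertex : Perm K.Flag :=
  Function.Involutive.toPerm (fun t => ⟨(t.1.2.1, t.1.1, t.1.2.2), K.swap12 _ _ _ t.2⟩)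
    (fun _ => rfl)

/-- Change the edge of a flag. -/
def flipEdge : Perm K.Flag :=
  Function.Involutive.toPerm (fun t => ⟨(t.1.1, t.1.2.2, t.1.2.1), K.swap23 _ _ _ t.2⟩)
    (fun _ => rfl)

theorem flipFace_flipFace (x : K.Flag) : K.flipFace (K.flipFace x) = x :=
  Function.Involutive.toPerm_involutive _ x

theorem flipEdge_flipEdge (x : K.Flag) : K.flipEdge (K.flipEdge x) = x := rfl

theorem flipFace_free (x : K.Flag) : K.flipFace x ≠ x := fun h =>
  K.op_ne _ _ _ x.2 (congrArg (fun t : K.Flag => t.1.2.2) h)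

theorem flipEdge_free (x : K.Flag) : K.flipEdge x ≠ x := fun h =>
  K.ne23 _ _ _ x.2 (congrArg (fun t : K.Flag => t.1.2.2) h)

theorem flip_conj : K.flipFace * (K.flipEdge * K.flipFace) =
    (K.flipEdge * K.flipFace)⁻¹ * K.flipFace := by
  rw [eq_inv_mul_iff_mul_eq]
  ext1 x
  simp [flipFace_flipFace, flipEdge_flipEdge]

theorem flag_transitive (a₀ b₀ c₀ : K.V) (h₀ : K.T a₀ b₀ c₀) (r : K.V → ℕ)
    (hr : ∀ a b c, K.T a b c → a = a₀ ∨
      ∃ k < 5, r ((fun t : K.V × K.V × K.V => (t.1, K.op t.1 t.2.1 t.2.2, t.2.1))^[k]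
        (a, b, c)).2.1 < r a)
    (hb : ∀ b c, K.T a₀ b c → ∃ k < 5,
      (fun t : K.V × K.V × K.V => (t.1, K.op t.1 t.2.1 t.2.2, t.2.1))^[k] (a₀, b, c) = (a₀, b₀, c₀) ∨
      (fun t : K.V × K.V × K.V => (t.1, K.op t.1 t.2.1 t.2.2, t.2.1))^[k] (a₀, b, K.op a₀ b c) =
        (a₀, b₀, c₀))
    (x y : K.Flag) :
    ∃ g ∈ Subgroup.closure {K.flipFace, K.flipVertex, K.flipEdge * K.flipFace}, g x = y := by
  set G := Subgroup.closure {K.flipFace, K.flipVertex, K.flipEdge * K.flipFace} with hG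
  have hα : K.flipFace ∈ G := Subgroup.subset_closure (by simp)
  have hβ : K.flipVertex ∈ G := Subgroup.subset_closure (by simp)
  have hP : K.flipEdge * K.flipFace ∈ G := Subgroup.subset_closure (by simp)
  have hit : ∀ (k : ℕ) (x : K.Flag), (((K.flipEdge * K.flipFace) ^ k) x).1 =
      (fun t : K.V × K.V × K.V => (t.1, K.op t.1 t.2.1 t.2.2, t.2.1))^[k] x.1 := by
    intro k
    induction k with
    | zero => intro x; rfl
    | succ k ih =>
      intro x
      rw [pow_succ, Function.iterate_succ_apply]
      exact ih _
  have main : ∀ (n : ℕ) (x : K.Flag), r x.1.1 = n →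
      ∃ g ∈ G, g x = ⟨(a₀, b₀, c₀), h₀⟩ := by
    intro n
    induction n using Nat.strong_induction_on with
    | _ n ih =>
      intro x hx
      rcases hr _ _ _ x.2 with ha | ⟨k, -, hk⟩
      · obtain ⟨⟨a, b, c⟩, hT⟩ := x
        simp only at ha
        subst ha
        obtain ⟨k, -, hk | hk⟩ := hb b c hT
        · exact ⟨_, G.pow_mem hP k, Subtype.ext ((hit k _).trans hk)⟩
        · refine ⟨_, G.mul_mem (G.pow_mem hP k) hα, Subtype.ext ?_⟩
          exact (hit k (K.flipFace ⟨(a, b, c), hT⟩)).trans hk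
      · obtain ⟨g, hg, e⟩ := ih _ (hx ▸ hk)
          (K.flipVertex (((K.flipEdge * K.flipFace) ^ k) x)) (by
            change r (((K.flipEdge * K.flipFace) ^ k) x).1.2.1 = _
            rw [hit])
        exact ⟨g * (K.flipVertex * (K.flipEdge * K.flipFace) ^ k),
          G.mul_mem hg (G.mul_mem hβ (G.pow_mem hP k)), e⟩
  obtain ⟨g, hg, e⟩ := main _ x rfl
  obtain ⟨k, hk, e'⟩ := main _ y rfl
  exact ⟨k⁻¹ * g, G.mul_mem (G.inv_mem hk) hg, by simp [e, ← e']⟩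

/-- The map of a connected triangulated closed surface, on the set of its flags. -/
def toMap (hne : Nonempty K.Flag)
    (hc : ∀ x y, ∃ g ∈ Subgroup.closure {K.flipFace, K.flipVertex, K.flipEdge * K.flipFace},
      g x = y) : TutteMap where
  X := K.Flag
  finite := by have := K.finite; unfold Flag; infer_instance
  nonempty := hne
  α := K.flipFace
  β := K.flipVertex
  P := K.flipEdge * K.flipFace
  α_invol := K.flipFace_flipFace
  β_invol := fun _ => rfl
  α_β_comm := fun x => Subtype.ext (by
    change (x.1.2.1, x.1.1, K.op x.1.2.1 x.1.1 x.1.2.2) =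
      (x.1.2.1, x.1.1, K.op x.1.1 x.1.2.1 x.1.2.2)
    rw [K.op_comm _ _ _ x.2])
  α_free := K.flipFace_free
  β_free := fun x h => K.ne12 _ _ _ x.2 (congrArg (fun t : K.Flag => t.1.2.1) h)
  αβ_free := fun x h => K.ne12 _ _ _ x.2 (congrArg (fun t : K.Flag => t.1.2.1) h)
  basic := TutteMap.basic_of_free _ _ K.flip_conj K.flipFace_free (fun x h => by
    simp only [Perm.mul_apply, flipFace_flipFace] at h
    exact K.flipEdge_free x h)
  α_P := K.flip_conj
  transitive := hc

end TriComplex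

/-- The other common neighbour: the first `d ≠ c` in a list with `T a b d`. -/
def findOther {V : Type} [DecidableEq V] (l : List V) (T : V → V → V → Bool) (a b c : V) : V :=
  (l.find? fun d => T a b d && d ≠ c).getD c

namespace Icosahedron

/-- The twelve vertices of the icosahedron: `(true, none)` and `(false, none)` are the two poles,
`(true, some i)` and `(false, some i)` are the pentagons around them; `(s, v)` and `(!s, v)` are
antipodal. -/
abbrev Vert : Type := Bool × Option (Fin 5)

/-- Adjacency in the icosahedron: each pole is adjacent to the vertices of its own pentagon, the
pentagons are 5-cycles, and `(s, some i)` is adjacent to the two vertices `(!s, some (i ± 2))` of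
the other pentagon. -/
def adj : Vert → Vert → Bool
  | (_, none), (_, none) => false
  | (s, none), (t, some _) => s == t
  | (s, some _), (t, none) => s == t
  | (s, some i), (t, some j) =>
    if i = j then false else if j = i + 1 ∨ i = j + 1 then s == t else s != t

/-- The twenty faces of the icosahedron are the triples of mutually adjacent vertices. -/
def face (a b c : Vert) : Bool := adj a b && adj b c && adj a c

/-- The faces of the projective quotient: the images of the faces of the icosahedron under the
identification of antipodal vertices. -/
def projFace (a b c : Option (Fin 5)) : Bool :=
  [true, false].any fun s => [true, false].any fun t => [true, false].any fun u =>
    face (s, a) (t, b) (u, c)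

def projVerts : List (Option (Fin 5)) := none :: (List.finRange 5).map some

def verts : List Vert := projVerts.map (Prod.mk true) ++ projVerts.map (Prod.mk false)

set_option maxRecDepth 100000 in
/-- The boundary of the icosahedron. -/
def sphere : TriComplex where
  V := Vert
  finite := inferInstance
  T := face
  op := findOther verts face
  swap12 := by decide +kernel
  swap23 := by decide +kernel
  ne12 := by decide +kernel
  ne23 := by decide +kernel
  op_mem := by decide +kernel
  op_ne := by decide +kernel
  op_op := by decide +kernel
  op_comm := by decide +kernel

/-- The antipodal quotient of the boundary of the icosahedron. -/
def projective : TriComplex where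
  V := Option (Fin 5)
  finite := inferInstance
  T := projFace
  op := findOther projVerts projFace
  swap12 := by decide +kernel
  swap23 := by decide +kernel
  ne12 := by decide +kernel
  ne23 := by decide +kernel
  op_mem := by decide +kernel
  op_ne := by decide +kernel
  op_op := by decide +kernel
  op_comm := by decide +kernel

theorem sphere_transitive (x y : sphere.Flag) :
    ∃ g ∈ Subgroup.closure {sphere.flipFace, sphere.flipVertex,
      sphere.flipEdge * sphere.flipFace}, g x = y :=
  sphere.flag_transitive (true, none) (true, some 0) (true, some 1)
  (by decide +kernel) (fun v : Vert => if v = (false, none) then 12 else verts.idxOf v)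
  (by unfold sphere; decide +kernel) (by unfold sphere; decide +kernel) x y

theorem projective_transitive (x y : projective.Flag) :
    ∃ g ∈ Subgroup.closure {projective.flipFace, projective.flipVertex,
      projective.flipEdge * projective.flipFace}, g x = y :=
  projective.flag_transitive none (some 0) (some 1)
  (by decide +kernel) (fun v : Option (Fin 5) => projVerts.idxOf v)
  (by unfold projective; decide +kernel) (by unfold projective; decide +kernel) x y

end Icosahedron

/-- The icosahedron, a map with 20 triangles. -/
def O20 : TutteMap :=
  Icosahedron.sphere.toMap
    ⟨⟨((true, none), (true, some 0), (true, some 1)), by decide +kernel⟩⟩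
    Icosahedron.sphere_transitive

/-- The projective quotient of the icosahedron, a map with 10 triangles. -/
def P10 : TutteMap :=
  Icosahedron.projective.toMap ⟨⟨(none, some 0, some 1), by decide +kernel⟩⟩
    Icosahedron.projective_transitive

/-! ### Flags -/

/-! Put `γ = P * α`. The relation `α P = P⁻¹ α` and the basic condition make `γ` a fixed-point-free
involution, so a map is a connected set of flags with three free involutions `α`, `β`, `γ`, where
`α` and `β` commute and `αβ` is free. Vertices, edges and faces are the orbits of `⟨α, γ⟩`, `⟨α, β⟩`
and `⟨β, γ⟩`. Triangular means that `γβ` has order three everywhere, and orientable means that the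
flags have a 2-colouring reversed by all three involutions (`not_nonorientable_iff`).

Correspondence: each face of a triangular map has six flags, on which `β` and `γ` act as the two
generating transpositions of `Perm (Fin 3)` by right multiplication (`faceFlag_bijective`). The
flags are therefore the directed sides of disks, and `α` is the gluing. Looplessness puts the three
corners of a face at distinct vertices (`start_eq_of_vert_eq`), which gives the distinctness
conditions of a closed s-manifold.

Valency 5: the relations of a triangular map of valency five are the Coxeter relations of the full
icosahedral group, of order 120. Hence its Cayley graph maps equivariantly onto the flags
(`gen_develop`). The freeness conditions exclude from the stabiliser of a flag everything but the
identity and the central involution (`eq_or_eq_of_develop_eq`), leaving at most two maps; the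
icosahedron and its antipodal quotient have 120 and 60 flags.

Infinite families: cutting every triangle into four multiplies the number of flags by four, keeps
the old valencies and orientability, and creates only vertices of valency 6 (`valencies_subdiv`).
Iteration from a torus and a Klein bottle map of valency 6, the icosahedron, a Hurwitz map and a map
with valencies 5 and 7 settles all sets containing 6; counting flags gives Euler characteristic 0
when all valencies are 6. Valency 7 comes from the unbranched cyclic coverings of one Hurwitz map,
given by an integral cocycle (`valencies_cover`), and two explicit maps settle `{5, 7}`.

All examples are loopless, so both readings of the classification follow from the single assumption
that the admitted collection contains every loopless map. -/

/-- With `L = Prop` this expresses invariance of a subset under a group; with sets as labels,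
invariance of orbits. -/
theorem label_eq_of_mem_closure {X L : Type*} {T : Set (Perm X)} {v : X → L}
    (h : ∀ g ∈ T, ∀ x, v (g x) = v x) {g : Perm X} (hg : g ∈ Subgroup.closure T) (x : X) :
    v (g x) = v x := by
  induction hg using Subgroup.closure_induction generalizing x with
  | mem g hg => exact h g hg x
  | one => rfl
  | mul g k _ _ ihg ihk => rw [Perm.mul_apply, ihg, ihk]
  | inv g _ ih => rw [← ih (g⁻¹ x), ← Perm.mul_apply, mul_inv_cancel, Perm.one_apply]

theorem minimalPeriod_eq_of_forall_lt {X : Type*} {f : X → X} {x : X} {n : ℕ} (hn : 0 < n)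
    (h : f^[n] x = x) (h' : ∀ k < n, 0 < k → f^[k] x ≠ x) : Function.minimalPeriod f x = n := by
  refine le_antisymm (Function.IsPeriodicPt.minimalPeriod_le hn h) (not_lt.1 fun hlt => ?_)
  exact h' _ hlt (Function.IsPeriodicPt.minimalPeriod_pos hn h)
    (Function.isPeriodicPt_minimalPeriod f x)

theorem minimalPeriod_eq_three {X : Type*} {f : X → X} {x : X} (h : f (f (f x)) = x)
    (h' : f x ≠ x) : Function.minimalPeriod f x = 3 :=
  Function.minimalPeriod_eq_prime (p := 3) h h'

/-- The orbit of a point under the group generated by `T`. -/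
def orbitSet {X : Type} (T : Set (Perm X)) (x : X) : Set X :=
  {y | ∃ g ∈ Subgroup.closure T, g x = y}

theorem mem_orbitSet_self {X : Type} (T : Set (Perm X)) (x : X) : x ∈ orbitSet T x :=
  ⟨1, one_mem _, rfl⟩

theorem orbitSet_apply {X : Type} {T : Set (Perm X)} {g : Perm X} (hg : g ∈ Subgroup.closure T)
    (x : X) : orbitSet T (g x) = orbitSet T x := by
  ext y
  constructor
  · rintro ⟨k, hk, rfl⟩
    exact ⟨k * g, mul_mem hk hg, rfl⟩
  · rintro ⟨k, hk, rfl⟩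
    exact ⟨k * g⁻¹, mul_mem hk (inv_mem hg), by simp⟩

/-! ### Orbits of dihedral groups -/

section Dihedral

variable {X : Type} {Q a : Perm X}

theorem dihedral_zpow (hQ : a * Q = Q⁻¹ * a) (m : ℤ) (y : X) : a ((Q ^ m) y) = (Q ^ (-m)) (a y) := by
  have h : SemiconjBy a Q Q⁻¹ := hQ
  have h2 := h.zpow_right m
  rw [inv_zpow, ← zpow_neg] at h2
  exact Perm.congr_fun h2 y

theorem mem_orbitSet_dihedral (ha : ∀ x, a (a x) = x) (hQ : a * Q = Q⁻¹ * a) (x y : X) :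
    y ∈ orbitSet {Q, a} x ↔ ∃ k : ℤ, y = (Q ^ k) x ∨ y = a ((Q ^ k) x) := by
  have haG : a ∈ Subgroup.closure {Q, a} := Subgroup.subset_closure (by simp)
  have hQG : Q ∈ Subgroup.closure {Q, a} := Subgroup.subset_closure (by simp)
  constructor
  · rintro ⟨g, hg, rfl⟩
    suffices h : ∀ y, (∃ k : ℤ, g y = (Q ^ k) x ∨ g y = a ((Q ^ k) x)) ↔
        ∃ k : ℤ, y = (Q ^ k) x ∨ y = a ((Q ^ k) x) from (h x).2 ⟨0, Or.inl rfl⟩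
    intro y
    refine Eq.to_iff (label_eq_of_mem_closure
      (v := fun y => ∃ k : ℤ, y = (Q ^ k) x ∨ y = a ((Q ^ k) x)) ?_ hg y)
    intro k hk z
    have hQ1 : ∀ z, (∃ k : ℤ, z = (Q ^ k) x ∨ z = a ((Q ^ k) x)) →
        ∀ j : ℤ, ∃ k : ℤ, (Q ^ j) z = (Q ^ k) x ∨ (Q ^ j) z = a ((Q ^ k) x) := by
      rintro z ⟨k, rfl | rfl⟩ j
      · exact ⟨j + k, Or.inl (by rw [zpow_add]; rfl)⟩
      · refine ⟨-j + k, Or.inr ?_⟩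
        rw [zpow_add, Perm.mul_apply, dihedral_zpow hQ (-j), neg_neg]
    have ha1 : ∀ z, (∃ k : ℤ, z = (Q ^ k) x ∨ z = a ((Q ^ k) x)) →
        ∃ k : ℤ, a z = (Q ^ k) x ∨ a z = a ((Q ^ k) x) := by
      rintro z ⟨k, rfl | rfl⟩
      · exact ⟨k, Or.inr rfl⟩
      · exact ⟨k, Or.inl (ha _)⟩
    rcases hk with rfl | rfl
    · refine propext ⟨fun h => ?_, fun h => by simpa using hQ1 z h 1⟩
      simpa using hQ1 _ h (-1)
    · refine propext ⟨fun h => ?_, ha1 z⟩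
      have := ha1 _ h
      rwa [ha] at this
  · rintro ⟨k, rfl | rfl⟩
    · exact ⟨_, zpow_mem hQG k, rfl⟩
    · exact ⟨a * Q ^ k, mul_mem haG (zpow_mem hQG k), rfl⟩

theorem exists_lt_minimalPeriod [Finite X] (Q : Perm X) (x : X) (k : ℤ) :
    ∃ i < Function.minimalPeriod Q x, (Q ^ k) x = Q^[i] x := by
  have hx : x ∈ Function.periodicPts Q := by
    obtain ⟨n, hn, h⟩ := Function.Injective.mem_periodicPts Q.injective x
    exact ⟨n, hn, h⟩
  have hp := Function.minimalPeriod_pos_of_mem_periodicPts hx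
  have hper : ((Q ^ (Function.minimalPeriod Q x : ℤ) : Perm X)) x = x := by
    rw [zpow_natCast, ← Perm.iterate_eq_pow]
    exact Function.isPeriodicPt_minimalPeriod Q x
  set m := Function.minimalPeriod Q x
  have hz : (m : ℤ) ≠ 0 := by exact_mod_cast hp.ne'
  refine ⟨(k % m).toNat, ?_, ?_⟩
  · have := Int.emod_lt_of_pos k (b := m) (by exact_mod_cast hp)
    have := Int.emod_nonneg k hz
    omega
  · have h1 : k = (k % m) + m * (k / m) := (Int.emod_add_mul_ediv k m).symm
    have h2 : ((k % m).toNat : ℤ) = k % m := Int.toNat_of_nonneg (Int.emod_nonneg k hz)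
    conv_lhs => rw [h1]
    rw [zpow_add, Perm.mul_apply, zpow_mul, Perm.zpow_apply_eq_self_of_apply_eq_self hper, ← h2,
      zpow_natCast, ← Perm.iterate_eq_pow, h2]

/-- The orbit is the cycle of `x` together with its image under `a`; condition `hb` keeps the two
disjoint. Vertices, edges and faces are all counted this way. -/
theorem ncard_orbitSet_dihedral [Finite X] (ha : ∀ x, a (a x) = x) (hQ : a * Q = Q⁻¹ * a)
    (hb : ∀ (x : X) (k : ℤ), (Q ^ k) x ≠ a x) (x : X) :
    (orbitSet {Q, a} x).ncard = 2 * Function.minimalPeriod Q x := by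
  have hset : orbitSet {Q, a} x = ((fun i => Q^[i] x) '' Set.Iio (Function.minimalPeriod Q x)) ∪
      ((fun i => a (Q^[i] x)) '' Set.Iio (Function.minimalPeriod Q x)) := by
    ext y
    rw [mem_orbitSet_dihedral ha hQ]
    constructor
    · rintro ⟨k, rfl | rfl⟩ <;> obtain ⟨i, hi, h⟩ := exists_lt_minimalPeriod Q x k <;> rw [h]
      · exact Or.inl ⟨i, hi, rfl⟩
      · exact Or.inr ⟨i, hi, rfl⟩
    · rintro (⟨i, -, rfl⟩ | ⟨i, -, rfl⟩)
      · exact ⟨i, Or.inl (by simp [Perm.iterate_eq_pow])⟩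
      · exact ⟨i, Or.inr (by simp [Perm.iterate_eq_pow])⟩
  have hinj := Function.iterate_injOn_Iio_minimalPeriod (f := Q) (x := x)
  have hIio : (Set.Iio (Function.minimalPeriod Q x)).ncard = Function.minimalPeriod Q x := by
    rw [← Finset.coe_Iio, Set.ncard_coe_finset, Nat.card_Iio]
  rw [hset, Set.ncard_union_eq, hinj.ncard_image, Set.InjOn.ncard_image, hIio, two_mul]
  · exact fun i hi j hj h => hinj hi hj (a.injective h)
  · rw [Set.disjoint_left]
    rintro _ ⟨i, -, rfl⟩ ⟨j, -, h⟩
    refine hb (Q^[j] x) (i - j : ℤ) ?_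
    simp only at h
    rw [h, Perm.iterate_eq_pow, Perm.iterate_eq_pow, ← Perm.mul_apply, ← zpow_natCast,
      ← zpow_natCast, ← zpow_add]
    simp

end Dihedral

/-- If all orbits have `k` elements, then their number is the cardinality divided by `k`. -/
theorem orbitCount_mul {X : Type} [Finite X] {T : Set (Perm X)} {k : ℕ}
    (h : ∀ x, (orbitSet T x).ncard = k) : TutteMap.orbitCount T * k = Nat.card X := by
  have e := MulAction.selfEquivSigmaOrbits (Subgroup.closure T) X
  have hc : ∀ q : MulAction.orbitRel.Quotient (Subgroup.closure T) X,
      Nat.card (MulAction.orbit (Subgroup.closure T) q.out) = k := by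
    intro q
    rw [← h q.out, Nat.card_coe_set_eq]
    congr 1
    ext y
    constructor
    · rintro ⟨⟨g, hg⟩, rfl⟩
      exact ⟨g, hg, rfl⟩
    · rintro ⟨g, hg, rfl⟩
      exact ⟨⟨g, hg⟩, rfl⟩
  have := Fintype.ofFinite (MulAction.orbitRel.Quotient (Subgroup.closure T) X)
  rw [Nat.card_congr e, Nat.card_sigma, Finset.sum_congr rfl fun q _ => hc q]
  simp [TutteMap.orbitCount, Nat.card_eq_fintype_card]

/-! ### Flag involutions, counting of cells, orientability -/

namespace TutteMap

instance (M : TutteMap) : Finite M.X := M.finite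
instance (M : TutteMap) : Nonempty M.X := M.nonempty

variable (M : TutteMap)

/-- The involution that changes the edge of a flag. -/
def γ : Perm M.X := M.P * M.α

theorem α_mul_self : M.α * M.α = 1 := Equiv.ext M.α_invol

theorem P_apply (x : M.X) : M.P x = M.γ (M.α x) := by
  rw [γ, Perm.mul_apply, M.α_invol]

/-- This is equivalent to `α P = P⁻¹ α`, just as freeness of `γ` is the case `k = 1` of the basic
condition. -/
theorem γ_invol (x : M.X) : M.γ (M.γ x) = x := by
  have h : M.α * M.P * M.α = M.P⁻¹ := by rw [M.α_P, mul_assoc, α_mul_self, mul_one]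
  have : M.γ * M.γ = 1 := by
    rw [γ, mul_assoc, ← mul_assoc M.α, h, mul_inv_cancel]
  exact Perm.congr_fun this x

theorem γ_free (x : M.X) : M.γ x ≠ x := by
  intro h
  have h1 := M.basic (M.α x) 1
  rw [zpow_one, P_apply, M.α_invol] at h1
  exact h1 h

theorem Pαβ_apply (x : M.X) : (M.P * M.α * M.β) x = M.γ (M.β x) := rfl

/-- Transitivity as an induction principle. Closure in one direction suffices because the generators
are involutions. -/
theorem forall_mem {S : Set M.X} {x₀ : M.X} (h₀ : x₀ ∈ S) (hα : ∀ x ∈ S, M.α x ∈ S)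
    (hβ : ∀ x ∈ S, M.β x ∈ S) (hγ : ∀ x ∈ S, M.γ x ∈ S) (y : M.X) : y ∈ S := by
  obtain ⟨g, hg, rfl⟩ := M.transitive x₀ y
  have key : ∀ x, (g x ∈ S) = (x ∈ S) := by
    refine label_eq_of_mem_closure (v := fun x => x ∈ S) ?_ hg
    rintro k (rfl | rfl | rfl) x
    · exact propext ⟨fun h => by simpa [M.α_invol] using hα _ h, hα x⟩
    · exact propext ⟨fun h => by simpa [M.β_invol] using hβ _ h, hβ x⟩
    · rw [P_apply]
      exact propext ⟨fun h => by simpa [M.α_invol, M.γ_invol] using hα _ (hγ _ h),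
        fun h => hγ _ (hα x h)⟩
  rw [key]
  exact h₀

theorem iso_of_commute {M N : TutteMap} (ξ : M.X ≃ N.X) (hα : ∀ x, ξ (M.α x) = N.α (ξ x))
    (hβ : ∀ x, ξ (M.β x) = N.β (ξ x)) (hγ : ∀ x, ξ (M.γ x) = N.γ (ξ x)) : M.Iso N :=
  ⟨ξ, fun x => ⟨hα x, hβ x, by rw [P_apply, P_apply, hγ, hα]⟩⟩

theorem Iso.card_eq {M N : TutteMap} (h : M.Iso N) : Nat.card M.X = Nat.card N.X := by
  obtain ⟨ξ, -⟩ := h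
  exact Nat.card_congr ξ

variable {M}

/-- A labelling of the vertices that differs at the two ends of every edge certifies looplessness
without computing orbits. -/
theorem loopless_of_label {L : Type*} (v : M.X → L) (hα : ∀ x, v (M.α x) = v x)
    (hγ : ∀ x, v (M.γ x) = v x) (hβ : ∀ x, v (M.β x) ≠ v x) : M.Loopless := by
  rintro x ⟨g, hg, h⟩
  apply hβ x
  rw [← h]
  refine label_eq_of_mem_closure ?_ hg x
  rintro k (rfl | rfl) y
  · rw [P_apply, hγ, hα]
  · exact hα y

variable (M)

/-- The vertex of a flag, as a set of flags. -/
def vert (x : M.X) : Set M.X := orbitSet {M.P, M.α} x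

theorem vert_α (x : M.X) : M.vert (M.α x) = M.vert x :=
  orbitSet_apply (Subgroup.subset_closure (by simp)) x

theorem vert_γ (x : M.X) : M.vert (M.γ x) = M.vert x :=
  orbitSet_apply (mul_mem (Subgroup.subset_closure (by simp)) (Subgroup.subset_closure (by simp))) x

variable {M}

theorem Loopless.vert_β (h : M.Loopless) (x : M.X) : M.vert (M.β x) ≠ M.vert x := by
  intro h'
  exact h x (show M.β x ∈ M.vert x from h' ▸ mem_orbitSet_self _ _)

variable (M)

theorem ncard_vert (x : M.X) : (M.vert x).ncard = 2 * Function.minimalPeriod M.P x :=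
  ncard_orbitSet_dihedral M.α_invol M.α_P M.basic x

/-- The dual map: `α` and `β` exchange roles, and `γβ` takes the place of `P`. -/
theorem face_basic :
    M.β * (M.P * M.α * M.β) = (M.P * M.α * M.β)⁻¹ * M.β ∧
    ∀ (x : M.X) (k : ℤ), ((M.P * M.α * M.β) ^ k) x ≠ M.β x := by
  have h : M.β * (M.P * M.α * M.β) = (M.P * M.α * M.β)⁻¹ * M.β := by
    rw [eq_inv_mul_iff_mul_eq]
    ext1 x
    change M.γ (M.β (M.β (M.γ (M.β x)))) = M.β x
    rw [M.β_invol, M.γ_invol]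
  refine ⟨h, basic_of_free _ _ h M.β_free fun x => ?_⟩
  rw [Pαβ_apply, M.β_invol]
  exact M.γ_free x

theorem ncard_face (x : M.X) : (orbitSet {M.P * M.α * M.β, M.β} x).ncard =
    2 * Function.minimalPeriod (M.P * M.α * M.β) x :=
  ncard_orbitSet_dihedral M.β_invol M.face_basic.1 M.face_basic.2 x

/-- The Klein group is dihedral, generated by `β` and the rotation `αβ`, whose cycles have length
two. -/
theorem ncard_edge (x : M.X) : (orbitSet {M.α, M.β} x).ncard = 4 := by
  have hcl : Subgroup.closure {M.α, M.β} = Subgroup.closure {M.α * M.β, M.β} := by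
    apply le_antisymm <;> rw [Subgroup.closure_le] <;> rintro k (rfl | rfl)
    · have h1 : M.α * M.β ∈ Subgroup.closure {M.α * M.β, M.β} := Subgroup.subset_closure (by simp)
      have h2 : M.β ∈ Subgroup.closure {M.α * M.β, M.β} := Subgroup.subset_closure (by simp)
      simpa using mul_mem h1 (inv_mem h2)
    · exact Subgroup.subset_closure (by simp)
    · exact mul_mem (Subgroup.subset_closure (by simp)) (Subgroup.subset_closure (by simp))
    · exact Subgroup.subset_closure (by simp)
  have horb : orbitSet {M.α, M.β} x = orbitSet {M.α * M.β, M.β} x := by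
    rw [orbitSet, hcl, orbitSet]
  have hc : M.β * (M.α * M.β) = (M.α * M.β)⁻¹ * M.β := by
    rw [eq_inv_mul_iff_mul_eq]
    ext1 x
    simp [M.α_β_comm, M.β_invol, M.α_invol]
  rw [horb, ncard_orbitSet_dihedral M.β_invol hc (basic_of_free _ _ hc M.β_free fun x => by
    simpa [M.β_invol] using M.α_free x)]
  have h2 : Function.minimalPeriod (M.α * M.β) x = 2 := by
    refine Function.minimalPeriod_eq_prime (p := 2) ?_ (M.αβ_free x)
    change M.α (M.β (M.α (M.β x))) = x
    rw [M.α_β_comm, M.α_invol, M.β_invol]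
  rw [h2]

theorem edgeCount_mul : M.edgeCount * 4 = Nat.card M.X := orbitCount_mul M.ncard_edge

variable {M}

theorem Triangular.faceCount_mul (h : M.Triangular) : M.faceCount * 6 = Nat.card M.X :=
  orbitCount_mul fun x => by rw [ncard_face, h]

/-- A vertex has 12 flags, an edge 4 and a face 6, and 1/12 - 1/4 + 1/6 = 0. -/
theorem eulerChar_eq_zero (h : M.Triangular) (h6 : M.valencies = {6}) : M.eulerChar = 0 := by
  have hv : M.vertexCount * 12 = Nat.card M.X := by
    refine orbitCount_mul fun x => ?_
    have hx : Function.minimalPeriod M.P x ∈ M.valencies := ⟨x, rfl⟩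
    rw [h6] at hx
    have := M.ncard_vert x
    rw [show Function.minimalPeriod M.P x = 6 from hx] at this
    exact this
  have he := M.edgeCount_mul
  have hf := h.faceCount_mul
  unfold eulerChar
  omega

/-- A map is orientable if and only if its flags have a proper 2-colouring. -/
theorem not_nonorientable_iff : ¬ M.Nonorientable ↔ ∃ s : M.X → Bool,
    (∀ x, s (M.α x) = !s x) ∧ (∀ x, s (M.β x) = !s x) ∧ ∀ x, s (M.γ x) = !s x := by
  classical
  constructor
  · intro h
    simp only [Nonorientable, not_forall] at h
    obtain ⟨x₀, y₀, h⟩ := h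
    set T : Set (Perm M.X) := {M.α * M.β, M.P} with hT
    have hαβ : M.α * M.β ∈ Subgroup.closure T := Subgroup.subset_closure (by simp [hT])
    have hP : M.P ∈ Subgroup.closure T := Subgroup.subset_closure (by simp [hT])
    set O := orbitSet T with hO
    -- `α` commutes with `αβ` and inverts `P`, so it normalises `⟨αβ, P⟩` and permutes the orbits.
    have hα : ∀ x y, x ∈ O y → M.α x ∈ O (M.α y) := by
      rintro _ y ⟨g, hg, rfl⟩
      have key : ∀ y, O (M.α (g y)) = O (M.α y) := by
        refine label_eq_of_mem_closure (v := fun y => O (M.α y)) ?_ hg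
        rintro k (rfl | rfl) z
        · have : M.α ((M.α * M.β) z) = (M.α * M.β) (M.α z) := by
            simp [M.α_β_comm, M.α_invol]
          change O _ = O _
          rw [this]
          exact orbitSet_apply hαβ _
        · have : M.α (M.P z) = M.P⁻¹ (M.α z) := Perm.congr_fun M.α_P z
          change O _ = O _
          rw [this]
          exact orbitSet_apply (inv_mem hP) _
      exact key y ▸ mem_orbitSet_self _ _
    -- There are at most two orbits, `O x₀` and its image under `α`. They are disjoint, since
    -- otherwise `O x₀` would be everything; membership in `O x₀` is then the colouring.
    have hcover : ∀ x, x ∈ O x₀ ∨ M.α x ∈ O x₀ := by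
      have hm : ∀ {g} (_ : g ∈ Subgroup.closure T) x, x ∈ O x₀ → g x ∈ O x₀ := by
        rintro g hg x ⟨k, hk, rfl⟩
        exact ⟨g * k, mul_mem hg hk, rfl⟩
      refine M.forall_mem (S := {x | x ∈ O x₀ ∨ M.α x ∈ O x₀}) (x₀ := x₀)
        (Or.inl (mem_orbitSet_self _ _)) ?_ ?_ ?_
      · rintro x (h | h)
        · exact Or.inr (by rwa [M.α_invol])
        · exact Or.inl h
      · rintro x (h | h)
        · exact Or.inr (hm hαβ x h)
        · refine Or.inl ?_
          have := hm hαβ _ h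
          rwa [Perm.mul_apply, ← M.α_β_comm, M.α_invol] at this
      · rintro x (h | h)
        · refine Or.inr ?_
          have := hm (inv_mem hP) _ h
          have e : M.P⁻¹ x = M.α (M.γ x) := by
            rw [Perm.inv_eq_iff_eq, P_apply, M.α_invol, M.γ_invol]
          rwa [e] at this
        · refine Or.inl ?_
          have := hm hP _ h
          rwa [P_apply, M.α_invol] at this
    have hdisj : ∀ x, x ∈ O x₀ → M.α x ∉ O x₀ := by
      intro x hx hx'
      have h1 : M.α x ∈ O (M.α x₀) := hα _ _ hx
      have h2 : M.α x₀ ∈ O x₀ := by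
        obtain ⟨g, hg, e⟩ := h1
        obtain ⟨k, hk, e'⟩ := hx'
        exact ⟨g⁻¹ * k, mul_mem (inv_mem hg) hk, by simp [e', ← e]⟩
      have hall : ∀ x, x ∈ O x₀ := by
        intro x
        rcases hcover x with h | h
        · exact h
        · have := hα _ _ h
          rw [M.α_invol] at this
          obtain ⟨g, hg, e⟩ := h2
          obtain ⟨k, hk, e'⟩ := this
          exact ⟨k * g, mul_mem hk hg, by simp [e, e']⟩
      exact h (hall y₀)
    have hflip : ∀ x, (M.α x ∈ O x₀) = ¬ x ∈ O x₀ := fun x =>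
      propext ⟨fun h h' => hdisj x h' h, fun h => (hcover x).resolve_left h⟩
    have hm : ∀ {g} (_ : g ∈ Subgroup.closure T) x, (g x ∈ O x₀) = (x ∈ O x₀) := by
      intro g hg x
      refine propext ⟨?_, ?_⟩
      · rintro ⟨k, hk, e⟩
        exact ⟨g⁻¹ * k, mul_mem (inv_mem hg) hk, by simp [e]⟩
      · rintro ⟨k, hk, rfl⟩
        exact ⟨g * k, mul_mem hg hk, rfl⟩
    refine ⟨fun x => decide (x ∈ O x₀), fun x => ?_, fun x => ?_, fun x => ?_⟩
    · simp only [hflip, decide_not]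
    · have : M.β x = (M.α * M.β) (M.α x) := by simp [M.α_β_comm, M.α_invol]
      simp only [this, hm hαβ, hflip, decide_not]
    · have : M.γ x = M.P (M.α x) := rfl
      simp only [this, hm hP, hflip, decide_not]
  · rintro ⟨s, hα, hβ, hγ⟩ h
    obtain ⟨x⟩ := M.nonempty
    obtain ⟨g, hg, e⟩ := h x (M.α x)
    have := label_eq_of_mem_closure (v := s) (T := {M.α * M.β, M.P}) (by
      rintro k (rfl | rfl) y
      · simp [hα, hβ]
      · rw [P_apply, hγ, hα, Bool.not_not]) hg x
    rw [e, hα] at this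
    simp at this

end TutteMap

/-! ### Maps from three involutions on flags -/

/-- A map, given by the three involutions of its set of flags that change the face, the vertex and
the edge of a flag. -/
structure FlagSystem (X : Type) where
  base : X
  a : X → X
  b : X → X
  c : X → X
  a_invol : Function.Involutive a
  b_invol : Function.Involutive b
  c_invol : Function.Involutive c
  comm : ∀ x, a (b x) = b (a x)
  a_free : ∀ x, a x ≠ x
  b_free : ∀ x, b x ≠ x
  c_free : ∀ x, c x ≠ x
  ab_free : ∀ x, a (b x) ≠ x
  conn : ∀ S : Set X, base ∈ S → (∀ x ∈ S, a x ∈ S) → (∀ x ∈ S, b x ∈ S) → (∀ x ∈ S, c x ∈ S) →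
    ∀ x, x ∈ S

namespace FlagSystem

variable {X : Type} (F : FlagSystem X)

theorem conj : F.a_invol.toPerm * (F.c_invol.toPerm * F.a_invol.toPerm) =
    (F.c_invol.toPerm * F.a_invol.toPerm)⁻¹ * F.a_invol.toPerm := by
  rw [eq_inv_mul_iff_mul_eq]
  ext1 x
  simp [F.a_invol _, F.c_invol _]

theorem conj_free (x : X) : (F.c_invol.toPerm * F.a_invol.toPerm) ((F.a_invol.toPerm : Perm X) x) ≠ x := by
  change F.c (F.a (F.a x)) ≠ x
  rw [F.a_invol x]
  exact F.c_free x

/-- The map of a flag system. -/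
def toMap [Finite X] : TutteMap where
  X := X
  finite := inferInstance
  nonempty := ⟨F.base⟩
  α := F.a_invol.toPerm
  β := F.b_invol.toPerm
  P := F.c_invol.toPerm * F.a_invol.toPerm
  α_invol := F.a_invol
  β_invol := F.b_invol
  α_β_comm := F.comm
  α_free := F.a_free
  β_free := F.b_free
  αβ_free := F.ab_free
  basic := TutteMap.basic_of_free _ _ F.conj F.a_free F.conj_free
  α_P := F.conj
  transitive := by
    set G := Subgroup.closure {F.a_invol.toPerm, F.b_invol.toPerm,
      F.c_invol.toPerm * F.a_invol.toPerm} with hG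
    have ha : F.a_invol.toPerm ∈ G := Subgroup.subset_closure (by simp)
    have hb : F.b_invol.toPerm ∈ G := Subgroup.subset_closure (by simp)
    have hc : F.c_invol.toPerm ∈ G := by
      have : F.c_invol.toPerm * F.a_invol.toPerm ∈ G := Subgroup.subset_closure (by simp)
      simpa using mul_mem this (inv_mem ha)
    have key : ∀ x, ∃ g ∈ G, g F.base = x := by
      refine F.conn {x | ∃ g ∈ G, g F.base = x} ⟨1, one_mem _, rfl⟩ ?_ ?_ ?_
      · rintro _ ⟨g, hg, rfl⟩
        exact ⟨_, mul_mem ha hg, rfl⟩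
      · rintro _ ⟨g, hg, rfl⟩
        exact ⟨_, mul_mem hb hg, rfl⟩
      · rintro _ ⟨g, hg, rfl⟩
        exact ⟨_, mul_mem hc hg, rfl⟩
    intro x y
    obtain ⟨g, hg, rfl⟩ := key x
    obtain ⟨k, hk, rfl⟩ := key y
    exact ⟨k * g⁻¹, mul_mem hk (inv_mem hg), by simp⟩

variable [Finite X]

theorem toMap_γ (x : X) : F.toMap.γ x = F.c x := by
  change F.c (F.a (F.a x)) = F.c x
  rw [F.a_invol x]

theorem toMap_valencies :
    F.toMap.valencies = Set.range fun x => Function.minimalPeriod (fun y => F.c (F.a y)) x := rfl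

theorem toMap_not_nonorientable_iff : ¬ F.toMap.Nonorientable ↔ ∃ s : X → Bool,
    (∀ x, s (F.a x) = !s x) ∧ (∀ x, s (F.b x) = !s x) ∧ ∀ x, s (F.c x) = !s x := by
  rw [TutteMap.not_nonorientable_iff]
  exact exists_congr fun s => and_congr Iff.rfl (and_congr Iff.rfl
    (forall_congr' fun x => iff_of_eq (congrArg (fun y => s y = !s x) (F.toMap_γ x))))

theorem toMap_triangular (h : ∀ x, F.c (F.b (F.c (F.b (F.c (F.b x))))) = x)
    (h' : ∀ x, F.c (F.b x) ≠ x) : F.toMap.Triangular := by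
  have e : ∀ x, (F.toMap.P * F.toMap.α * F.toMap.β) x = F.c (F.b x) := fun x => F.toMap_γ (F.b x)
  intro x
  refine minimalPeriod_eq_three ?_ ?_
  · exact (e _).trans ((congrArg (F.c ∘ F.b) ((e _).trans (congrArg (F.c ∘ F.b) (e x)))).trans (h x))
  · rw [e]
    exact h' x

theorem toMap_loopless {L : Type*} (v : X → L) (ha : ∀ x, v (F.a x) = v x)
    (hc : ∀ x, v (F.c x) = v x) (hb : ∀ x, v (F.b x) ≠ v x) : F.toMap.Loopless :=
  TutteMap.loopless_of_label (M := F.toMap) v ha (fun x => (congrArg v (F.toMap_γ x)).trans (hc x)) hb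

end FlagSystem

/-! ### Subdivision of every triangle into four triangles -/

namespace TutteMap

variable {M : TutteMap}

theorem Triangular.γβ_cube (h : M.Triangular) (x : M.X) :
    M.γ (M.β (M.γ (M.β (M.γ (M.β x))))) = x := by
  have := Function.isPeriodicPt_minimalPeriod (M.P * M.α * M.β) x
  rw [h x] at this
  exact this

theorem Triangular.γβ_free (h : M.Triangular) (x : M.X) : M.γ (M.β x) ≠ x := by
  intro hx
  have h1 := Function.minimalPeriod_eq_one_iff_isFixedPt.2
    (show Function.IsFixedPt (M.P * M.α * M.β) x from hx)
  rw [h x] at h1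
  exact absurd h1 (by decide)

theorem Triangular.γβ_free' (h : M.Triangular) (x : M.X) : M.γ x ≠ M.β x := fun hx =>
  h.γβ_free x (by rw [← hx, M.γ_invol])

variable (M)

/-- The flags of the subdivision. A flag `x` with vertex `v` and edge `e` of a triangle with sides
`e` and `e'` at `v` contains the flags `(x, 0)`, `(x, 1)` on the half of `e` at `v`, and `(x, 2)`,
`(x, 3)` on the two sides of the segment from the midpoint of `e` to the midpoint of `e'`. -/
noncomputable def subdivFlags : FlagSystem (M.X × Fin 4) where
  base := (Classical.arbitrary M.X, 0)
  a := fun z => match z with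
    | (x, 0) => (M.α x, 0)
    | (x, 1) => (M.α x, 1)
    | (x, 2) => (x, 3)
    | (x, 3) => (x, 2)
  b := fun z => match z with
    | (x, 0) => (x, 1)
    | (x, 1) => (x, 0)
    | (x, 2) => (M.γ x, 2)
    | (x, 3) => (M.γ x, 3)
  c := fun z => match z with
    | (x, 0) => (M.γ x, 0)
    | (x, 1) => (x, 2)
    | (x, 2) => (x, 1)
    | (x, 3) => (M.β x, 3)
  a_invol := by rintro ⟨x, i⟩; fin_cases i <;> simp [M.α_invol]
  b_invol := by rintro ⟨x, i⟩; fin_cases i <;> simp [M.γ_invol]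
  c_invol := by rintro ⟨x, i⟩; fin_cases i <;> simp [M.γ_invol, M.β_invol]
  comm := by rintro ⟨x, i⟩; fin_cases i <;> simp
  a_free := by rintro ⟨x, i⟩; fin_cases i <;> simp [M.α_free]
  b_free := by rintro ⟨x, i⟩; fin_cases i <;> simp [M.γ_free]
  c_free := by rintro ⟨x, i⟩; fin_cases i <;> simp [M.γ_free, M.β_free]
  ab_free := by rintro ⟨x, i⟩; fin_cases i <;> simp
  conn := by
    intro S h0 ha hb hc
    have h01 : ∀ x, (x, 0) ∈ S → (x, 1) ∈ S := fun x h => hb _ h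
    have h12 : ∀ x, (x, 1) ∈ S → (x, 2) ∈ S := fun x h => hc _ h
    have h23 : ∀ x, (x, 2) ∈ S → (x, 3) ∈ S := fun x h => ha _ h
    have h32 : ∀ x, (x, 3) ∈ S → (x, 2) ∈ S := fun x h => ha _ h
    have h21 : ∀ x, (x, 2) ∈ S → (x, 1) ∈ S := fun x h => hc _ h
    have h10 : ∀ x, (x, 1) ∈ S → (x, 0) ∈ S := fun x h => hb _ h
    -- From `(x, 0)` to `(β x, 0)` the path descends to level 3, applies `β` along the middle
    -- triangle, and climbs back.
    have key : ∀ x, (x, 0) ∈ S :=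
      M.forall_mem (S := {x | (x, 0) ∈ S}) h0 (fun x h => ha _ h)
        (fun x h => h10 _ (h21 _ (h32 _ (hc _ (h23 _ (h12 _ (h01 _ h))))))) (fun x h => hc _ h)
    rintro ⟨x, i⟩
    fin_cases i
    · exact key x
    · exact h01 _ (key x)
    · exact h12 _ (h01 _ (key x))
    · exact h23 _ (h12 _ (h01 _ (key x)))

/-- The subdivision of a map. -/
noncomputable def subdiv : TutteMap := M.subdivFlags.toMap

variable {M}

theorem card_subdiv : Nat.card M.subdiv.X = Nat.card M.X * 4 := by
  change Nat.card (M.X × Fin 4) = _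
  simp

theorem Triangular.subdiv (h : M.Triangular) : M.subdiv.Triangular := by
  refine M.subdivFlags.toMap_triangular ?_ ?_
  · rintro ⟨x, i⟩
    fin_cases i
    · simp [subdivFlags, M.γ_invol]
    · simp [subdivFlags, M.γ_invol]
    · simp [subdivFlags, M.γ_invol]
    · have e : M.β (M.γ (M.β (M.γ (M.β (M.γ x))))) = x := by
        have := h.γβ_cube (M.γ x)
        rw [← M.γ_invol (M.β _), this, M.γ_invol]
      simp [subdivFlags, e]
  · rintro ⟨x, i⟩
    fin_cases i
    · simp [subdivFlags]
    · simp [subdivFlags, M.γ_free]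
    · simp [subdivFlags]
    · simp only [subdivFlags, ne_eq, Prod.mk.injEq]
      intro e
      refine h.γβ_free' x ?_
      rw [← M.β_invol (M.γ x)]
      exact congrArg M.β e.1

/-- The flags `(x, 0)` reproduce the rotation at the old vertices. At the midpoint of an edge three
steps of the rotation take `(x, 1)` to `(β (α x), 1)`, and `αβ` is a free involution, so the cycle
has length six. -/
theorem valencies_subdiv : M.subdiv.valencies = M.valencies ∪ {6} := by
  set P := fun z => M.subdivFlags.c (M.subdivFlags.a z) with hP
  have h0 : ∀ x : M.X, Function.minimalPeriod P (x, 0) = Function.minimalPeriod M.P x := by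
    intro x
    have it : ∀ (n : ℕ) (x : M.X), P^[n] (x, 0) = (M.P^[n] x, 0) := by
      intro n
      induction n with
      | zero => intro x; rfl
      | succ n ih =>
        intro x
        rw [Function.iterate_succ_apply, Function.iterate_succ_apply, M.P_apply, ← ih]
        rfl
    refine Function.minimalPeriod_eq_minimalPeriod_iff.2 fun n => ?_
    simp only [Function.IsPeriodicPt, Function.IsFixedPt]
    rw [it]
    exact ⟨fun h => congrArg Prod.fst h, fun h => congrArg (fun y => (y, (0 : Fin 4))) h⟩
  have h1 : ∀ x : M.X, P (x, 1) = (M.α x, 2) := fun _ => rfl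
  have h2 : ∀ x : M.X, P (x, 2) = (M.β x, 3) := fun _ => rfl
  have h3 : ∀ x : M.X, P (x, 3) = (x, 1) := fun _ => rfl
  have e1 : ∀ x, M.β (M.α x) = M.α (M.β x) := fun x => (M.α_β_comm x).symm
  have h6 : ∀ (x : M.X) (i : Fin 4), i ≠ 0 → Function.minimalPeriod P (x, i) = 6 := by
    intro x i hi
    clear_value P
    refine minimalPeriod_eq_of_forall_lt (by norm_num) ?_ ?_
    · fin_cases i
      · exact absurd rfl hi
      all_goals simp [h1, h2, h3, e1, M.α_invol, M.β_invol]
    · intro k hk hk'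
      fin_cases i
      · exact absurd rfl hi
      all_goals
        interval_cases k <;>
          simp [h1, h2, h3, e1, M.α_invol, M.β_invol, M.αβ_free]
  rw [subdiv, FlagSystem.toMap_valencies]
  ext n
  constructor
  · rintro ⟨⟨x, i⟩, rfl⟩
    by_cases hi : i = 0
    · subst hi
      exact Or.inl ⟨x, (h0 x).symm⟩
    · exact Or.inr (h6 x i hi)
  · rintro (⟨x, rfl⟩ | rfl)
    · exact ⟨(x, 0), h0 x⟩
    · obtain ⟨x⟩ := M.nonempty
      exact ⟨(x, 1), h6 x 1 (by decide)⟩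

theorem γ_ne_α (h : 1 ∉ M.valencies) (x : M.X) : M.γ x ≠ M.α x := by
  intro e
  refine h ⟨M.α x, ?_⟩
  rw [Function.minimalPeriod_eq_one_iff_isFixedPt, Function.IsFixedPt, M.P_apply, M.α_invol, e]

theorem Loopless.γ_ne_αβ (h : M.Loopless) (x : M.X) : M.γ x ≠ M.α (M.β x) := by
  intro e
  refine h.vert_β x ?_
  rw [← M.vert_α, ← e, M.vert_γ]

/-- A new vertex is the midpoint of an old edge, so the labels are old vertices and old edges. A
segment inside a triangle joins the midpoints of the edges of `x` and `γ x`. These edges coincide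
only if `γ x` is `α x`, `β x` or `αβ x`, which means valency one, a face that is not a triangle, or
a loop. -/
theorem Loopless.subdiv (h : M.Loopless) (ht : M.Triangular) (h1 : 1 ∉ M.valencies) :
    M.subdiv.Loopless := by
  let E : M.X → Set M.X := orbitSet {M.α, M.β}
  have hE : ∀ x y, y ∈ E x → y = x ∨ y = M.α x ∨ y = M.β x ∨ y = M.α (M.β x) := by
    rintro x _ ⟨g, hg, rfl⟩
    have key := label_eq_of_mem_closure
      (v := fun y => y = x ∨ y = M.α x ∨ y = M.β x ∨ y = M.α (M.β x)) ?_ hg x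
    · exact key ▸ Or.inl rfl
    have e : ∀ y z, M.α y = z ↔ y = M.α z := fun y z =>
      ⟨fun h => by rw [← h, M.α_invol], fun h => by rw [h, M.α_invol]⟩
    have e' : ∀ y z, M.β y = z ↔ y = M.β z := fun y z =>
      ⟨fun h => by rw [← h, M.β_invol], fun h => by rw [h, M.β_invol]⟩
    rintro k (rfl | rfl) y
    · simp only [e, M.α_invol]
      exact propext (by tauto)
    · simp only [e', M.β_invol, ← M.α_β_comm]
      exact propext (by tauto)
  have hα : ∀ x, E (M.α x) = E x := orbitSet_apply (Subgroup.subset_closure (by simp))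
  have hβ : ∀ x, E (M.β x) = E x := orbitSet_apply (Subgroup.subset_closure (by simp))
  have hγ : ∀ x, E (M.γ x) ≠ E x := by
    intro x e
    rcases hE x (M.γ x) (e ▸ mem_orbitSet_self _ _) with e | e | e | e
    · exact M.γ_free _ e
    · exact γ_ne_α h1 _ e
    · exact ht.γβ_free' _ e
    · exact h.γ_ne_αβ _ e
  refine M.subdivFlags.toMap_loopless
    (fun z : M.X × Fin 4 => if z.2 = 0 then (true, M.vert z.1) else (false, E z.1)) ?_ ?_ ?_
  · rintro ⟨x, i⟩
    fin_cases i <;> simp [subdivFlags, M.vert_α, hα]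
  · rintro ⟨x, i⟩
    fin_cases i <;> simp [subdivFlags, M.vert_γ, hβ]
  · rintro ⟨x, i⟩
    fin_cases i <;> simp [subdivFlags, hγ]

theorem subdiv_nonorientable_iff : M.subdiv.Nonorientable ↔ M.Nonorientable := by
  rw [← not_iff_not, subdiv, FlagSystem.toMap_not_nonorientable_iff, not_nonorientable_iff]
  constructor
  · rintro ⟨s, ha, hb, hc⟩
    -- Levels 0 and 3 of one flag are three involutions apart.
    have h3 : ∀ x : M.X, s (x, 3) = !s (x, 0) := fun x => by
      rw [← Bool.not_not (s (x, 0)), ← hb, ← hc, ← ha]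
      rfl
    refine ⟨fun x => s (x, 0), fun x => ha (x, 0), fun x => ?_, fun x => hc (x, 0)⟩
    have : s (M.β x, 3) = !s (x, 3) := hc (x, 3)
    rw [h3, h3] at this
    simpa using this
  · rintro ⟨s, hα, hβ, hγ⟩
    refine ⟨fun z => if z.2 = 0 ∨ z.2 = 2 then s z.1 else !s z.1, ?_, ?_, ?_⟩ <;>
    · rintro ⟨x, i⟩
      fin_cases i <;> simp [subdivFlags, hα, hβ, hγ]

/-- Iterated subdivisions are pairwise non-isomorphic. -/
theorem class_subdiv_iterate_injective (M : TutteMap) :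
    Function.Injective fun k : ℕ => (⟦subdiv^[k] M⟧ : Class) := by
  have hc : ∀ k, Nat.card (subdiv^[k] M).X = Nat.card M.X * 4 ^ k := by
    intro k
    induction k with
    | zero => simp
    | succ k ih => rw [Function.iterate_succ_apply', card_subdiv, ih]; ring
  intro i j h
  have := (Quotient.exact h : Iso _ _).card_eq
  rw [hc, hc] at this
  exact Nat.pow_right_injective (le_refl 2 |>.trans (by decide)) (Nat.eq_of_mul_eq_mul_left Nat.card_pos this)

theorem subdiv_iterate {V : Set ℕ} (h : M.Loopless) (ht : M.Triangular) (hv : M.valencies = V)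
    (h1 : 1 ∉ V) (k : ℕ) : (subdiv^[k + 1] M).Loopless ∧ (subdiv^[k + 1] M).Triangular ∧
      (subdiv^[k + 1] M).valencies = V ∪ {6} ∧
      ((subdiv^[k + 1] M).Nonorientable ↔ M.Nonorientable) := by
  induction k with
  | zero =>
    exact ⟨h.subdiv ht (hv ▸ h1), ht.subdiv, by rw [← hv]; exact valencies_subdiv,
      subdiv_nonorientable_iff⟩
  | succ k ih =>
    obtain ⟨i1, i2, i3, i4⟩ := ih
    rw [Function.iterate_succ_apply']
    refine ⟨i1.subdiv i2 ?_, i2.subdiv, ?_, subdiv_nonorientable_iff.trans i4⟩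
    · rw [i3]
      simp [h1]
    · rw [valencies_subdiv, i3, Set.union_assoc, Set.union_self]

end TutteMap

/-! ### Cyclic coverings -/

namespace TutteMap

/-- An integral cocycle on a map: the flags of each face are joined by paths of weight zero, the
weights of the edges crossed around each vertex add up to zero, all flags can be reached by paths
of weight zero, and some edge has weight one. -/
structure Cocycle (M : TutteMap) where
  w : M.X → ℤ
  w_α : ∀ x, w (M.α x) = -w x
  w_β : ∀ x, w (M.β x) = w x
  w_vertex : ∀ x, ∑ i ∈ Finset.range (Function.minimalPeriod M.P x), w (M.P^[i] x) = 0
  base : M.X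
  conn : ∀ S : Set M.X, base ∈ S → (∀ x ∈ S, w x = 0 → M.α x ∈ S) → (∀ x ∈ S, M.β x ∈ S) →
    (∀ x ∈ S, M.γ x ∈ S) → ∀ x, x ∈ S
  unit : ∃ x, w x = 1

namespace Cocycle

variable {M : TutteMap} (c : M.Cocycle) (n : ℕ) [NeZero n]

/-- The flags of the cyclic covering with `n` sheets defined by a cocycle. -/
def coverFlags : FlagSystem (M.X × ZMod n) where
  base := (c.base, 0)
  a := fun z => (M.α z.1, z.2 + c.w z.1)
  b := fun z => (M.β z.1, z.2)
  c := fun z => (M.γ z.1, z.2)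
  a_invol := by rintro ⟨x, i⟩; simp [M.α_invol, c.w_α]
  b_invol := by rintro ⟨x, i⟩; simp [M.β_invol]
  c_invol := by rintro ⟨x, i⟩; simp [M.γ_invol]
  comm := by rintro ⟨x, i⟩; simp [M.α_β_comm, c.w_β]
  a_free := fun z h => M.α_free z.1 (congrArg Prod.fst h)
  b_free := fun z h => M.β_free z.1 (congrArg Prod.fst h)
  c_free := fun z h => M.γ_free z.1 (congrArg Prod.fst h)
  ab_free := fun z h => M.αβ_free z.1 (congrArg Prod.fst h)
  conn := by
    intro S h0 ha hb hc
    have sheet : ∀ k, (c.base, k) ∈ S → ∀ x, (x, k) ∈ S := by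
      intro k hk
      refine c.conn {x | (x, k) ∈ S} hk (fun x hx h => ?_) (fun x hx => hb _ hx) fun x hx => hc _ hx
      have := ha _ hx
      simpa [h] using this
    have all : ∀ k : ℕ, (c.base, (k : ZMod n)) ∈ S := by
      intro k
      induction k with
      | zero => simpa using h0
      | succ k ih =>
        obtain ⟨x, hx⟩ := c.unit
        have h1 : (M.α x, (k : ZMod n) + 1) ∈ S := by simpa [hx] using ha _ (sheet _ ih x)
        push_cast
        by_contra hcon
        -- `conn` propagates membership only from the base flag, while sheet `k + 1` is entered
        -- elsewhere, at `α x`. It is therefore applied to the complement of `S`, which is closed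
        -- under the same moves.
        have hcompl : ∀ y, (y, (k : ZMod n) + 1) ∈ Sᶜ := by
          refine c.conn {y | (y, (k : ZMod n) + 1) ∈ Sᶜ} hcon (fun y hy hw hy' => hy ?_)
            (fun y hy hy' => hy ?_) fun y hy hy' => hy ?_
          · simpa [M.α_invol, c.w_α, hw] using ha _ hy'
          · simpa [M.β_invol] using hb _ hy'
          · simpa [M.γ_invol] using hc _ hy'
        exact hcompl _ h1
    rintro ⟨x, k⟩
    have := sheet _ (all k.val) x
    rwa [ZMod.natCast_zmod_val] at this

/-- The cyclic covering with `n` sheets defined by a cocycle. -/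
def cover : TutteMap := (c.coverFlags n).toMap

theorem card_cover : Nat.card (c.cover n).X = Nat.card M.X * n := by
  change Nat.card (M.X × ZMod n) = _
  simp

theorem cover_triangular (h : M.Triangular) : (c.cover n).Triangular :=
  (c.coverFlags n).toMap_triangular (fun z => Prod.ext (h.γβ_cube z.1) rfl)
    fun z hz => h.γβ_free z.1 (congrArg Prod.fst hz)

theorem cover_loopless (h : M.Loopless) : (c.cover n).Loopless :=
  (c.coverFlags n).toMap_loopless (fun z => M.vert z.1) (fun z => M.vert_α z.1)
    (fun z => M.vert_γ z.1) fun z => h.vert_β z.1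

/-- Rotation about a vertex shifts the sheet by the partial sums of weights. A full turn sums to
zero by `w_vertex`, so the covering is unbranched at vertices. -/
theorem valencies_cover : (c.cover n).valencies = M.valencies := by
  set P := fun z => (c.coverFlags n).c ((c.coverFlags n).a z) with hP
  have it : ∀ (j : ℕ) (z : M.X × ZMod n), P^[j] z =
      (M.P^[j] z.1, z.2 + ((∑ i ∈ Finset.range j, c.w (M.P^[i] z.1) : ℤ) : ZMod n)) := by
    intro j
    induction j with
    | zero => intro z; simp
    | succ j ih =>
      intro z
      rw [Function.iterate_succ_apply', ih, Function.iterate_succ_apply', Finset.sum_range_succ]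
      simp only [hP, coverFlags, M.P_apply]
      push_cast
      rw [add_assoc]
  have hper : ∀ z, Function.minimalPeriod P z = Function.minimalPeriod M.P z.1 := by
    intro z
    apply Nat.dvd_antisymm
    · rw [← Function.isPeriodicPt_iff_minimalPeriod_dvd, Function.IsPeriodicPt,
        Function.IsFixedPt, it, c.w_vertex]
      exact Prod.ext (Function.isPeriodicPt_minimalPeriod M.P z.1) (by simp)
    · rw [← Function.isPeriodicPt_iff_minimalPeriod_dvd]
      have := Function.isPeriodicPt_minimalPeriod P z
      rw [Function.IsPeriodicPt, Function.IsFixedPt, it] at this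
      exact congrArg Prod.fst this
  rw [cover, FlagSystem.toMap_valencies]
  ext m
  constructor
  · rintro ⟨z, rfl⟩
    exact ⟨z.1, (hper z).symm⟩
  · rintro ⟨x, rfl⟩
    exact ⟨(x, 0), hper (x, 0)⟩

end Cocycle

/-- The cyclic coverings of a map are pairwise non-isomorphic. -/
theorem Cocycle.class_cover_injective {M : TutteMap} (c : M.Cocycle) :
    Function.Injective fun k : ℕ => (⟦c.cover (k + 1)⟧ : Class) := by
  intro i j h
  have := (Quotient.exact h : Iso _ _).card_eq
  rw [card_cover, card_cover] at this
  have := Nat.eq_of_mul_eq_mul_left Nat.card_pos this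
  omega

end TutteMap

/-! ### Some small maps -/

namespace FlagSystem

/-- The function on `Fin n` with a given list of values. -/
def look (n : ℕ) [NeZero n] (l : List ℕ) (i : Fin n) : Fin n := Fin.ofNat n (l.getD i 0)

/-- The tables number the flags so that each one other than `0` has a smaller neighbour;
connectedness becomes a finite check. -/
theorem forall_mem_of_descent {n : ℕ} [NeZero n] {S : Set (Fin n)} (h0 : 0 ∈ S)
    (h : ∀ i, i ≠ 0 → ∃ j < i, j ∈ S → i ∈ S) (i : Fin n) : i ∈ S := by
  induction i using WellFoundedLT.induction with
  | _ i ih =>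
    by_cases hi : i = 0
    · exact hi ▸ h0
    · obtain ⟨j, hj, hS⟩ := h i hi
      exact hS (ih j hj)

/-- The flag system on `Fin n` with given tables of the three involutions. -/
def ofTable (n : ℕ) [NeZero n] (A B C : List ℕ)
    (h : ∀ i : Fin n, (look n A (look n A i) = i ∧ look n B (look n B i) = i ∧
      look n C (look n C i) = i ∧ look n A (look n B i) = look n B (look n A i)) ∧
      (look n A i ≠ i ∧ look n B i ≠ i ∧ look n C i ≠ i ∧ look n A (look n B i) ≠ i) ∧
      (i ≠ 0 → look n B i < i ∨ look n C i < i ∨ look n A i < i)) : FlagSystem (Fin n) where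
  base := 0
  a := look n A
  b := look n B
  c := look n C
  a_invol := fun i => (h i).1.1
  b_invol := fun i => (h i).1.2.1
  c_invol := fun i => (h i).1.2.2.1
  comm := fun i => (h i).1.2.2.2
  a_free := fun i => (h i).2.1.1
  b_free := fun i => (h i).2.1.2.1
  c_free := fun i => (h i).2.1.2.2.1
  ab_free := fun i => (h i).2.1.2.2.2
  conn := by
    intro S h0 ha hb hc
    refine forall_mem_of_descent h0 fun i hi => ?_
    rcases (h i).2.2 hi with h' | h' | h'
    · exact ⟨_, h', fun hS => (h i).1.2.1 ▸ hb _ hS⟩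
    · exact ⟨_, h', fun hS => (h i).1.2.2.1 ▸ hc _ hS⟩
    · exact ⟨_, h', fun hS => (h i).1.1 ▸ ha _ hS⟩

variable {n : ℕ} (F : FlagSystem (Fin n))

/-- Replaces minimal periods by decidable conditions on finitely many iterates. -/
theorem toMap_valencies_eq {V : List ℕ} (hpos : ∀ m ∈ V, 0 < m)
    (h : ∀ i, ∃ m ∈ V, (fun j => F.c (F.a j))^[m] i = i ∧
      ∀ k < m, 0 < k → (fun j => F.c (F.a j))^[k] i ≠ i)
    (h' : ∀ m ∈ V, ∃ i, (fun j => F.c (F.a j))^[m] i = i ∧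
      ∀ k < m, 0 < k → (fun j => F.c (F.a j))^[k] i ≠ i) :
    F.toMap.valencies = {m | m ∈ V} := by
  rw [toMap_valencies]
  ext m
  constructor
  · rintro ⟨i, rfl⟩
    obtain ⟨m, hm, h1, h2⟩ := h i
    simp only
    rwa [minimalPeriod_eq_of_forall_lt (hpos m hm) h1 h2]
  · intro hm
    obtain ⟨i, h1, h2⟩ := h' m hm
    exact ⟨i, minimalPeriod_eq_of_forall_lt (hpos m hm) h1 h2⟩

end FlagSystem

open FlagSystem

/-- A triangular map on the torus with three vertices, all of valency 6. -/
def torusFlags : FlagSystem (Fin 36) := ofTable 36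
    [1, 0, 4, 7, 2, 10, 12, 3, 14, 16, 5, 18, 6, 20, 8, 23, 9, 25, 11, 28, 13, 29, 27, 15, 26,
     17, 24, 22, 19, 21, 33, 34, 35, 30, 31, 32]
    [2, 4, 0, 8, 1, 11, 13, 14, 3, 17, 18, 5, 20, 6, 7, 24, 25, 9, 10, 29, 12, 28, 31, 26, 15,
     16, 23, 34, 21, 19, 35, 22, 33, 32, 27, 30]
    [3, 5, 6, 0, 9, 1, 2, 15, 13, 4, 19, 17, 21, 8, 22, 7, 26, 11, 27, 10, 30, 12, 14, 32, 31,
     33, 16, 18, 35, 34, 20, 24, 23, 25, 29, 28]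
    (by decide +kernel)

theorem torusFlags_triangular : torusFlags.toMap.Triangular :=
  torusFlags.toMap_triangular (by decide +kernel) (by decide +kernel)

theorem torusFlags_loopless : torusFlags.toMap.Loopless :=
  torusFlags.toMap_loopless (fun i => List.getD
    [0, 0, 1, 0, 1, 0, 1, 0, 2, 1, 0, 2, 1, 2, 2, 0, 1, 2, 2, 0, 2, 1, 2, 0, 1, 2, 1, 2, 0, 1,
     2, 1, 0, 2, 1, 0]
    i 0) (by decide +kernel) (by decide +kernel) (by decide +kernel)

/-- A triangular map on the Klein bottle with three vertices, all of valency 6. -/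
def kleinFlags : FlagSystem (Fin 36) := ofTable 36
    [1, 0, 4, 7, 2, 10, 12, 3, 14, 16, 5, 18, 6, 20, 8, 23, 9, 22, 11, 26, 13, 27, 17, 15, 29,
     31, 19, 21, 34, 24, 33, 25, 35, 30, 28, 32]
    [2, 4, 0, 8, 1, 11, 13, 14, 3, 17, 18, 5, 20, 6, 7, 24, 22, 9, 10, 27, 12, 26, 16, 29, 15,
     32, 21, 19, 33, 23, 34, 35, 25, 28, 30, 31]
    [3, 5, 6, 0, 9, 1, 2, 15, 13, 4, 19, 17, 21, 8, 22, 7, 24, 11, 25, 10, 28, 12, 14, 30, 16,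
     18, 33, 32, 20, 35, 23, 34, 27, 26, 31, 29]
    (by decide +kernel)

theorem kleinFlags_triangular : kleinFlags.toMap.Triangular :=
  kleinFlags.toMap_triangular (by decide +kernel) (by decide +kernel)

theorem kleinFlags_loopless : kleinFlags.toMap.Loopless :=
  kleinFlags.toMap_loopless (fun i => List.getD
    [0, 0, 1, 0, 1, 0, 1, 0, 2, 1, 0, 2, 1, 2, 2, 0, 1, 2, 2, 0, 2, 1, 2, 0, 1, 2, 0, 1, 2, 1,
     0, 2, 1, 0, 2, 1]
    i 0) (by decide +kernel) (by decide +kernel) (by decide +kernel)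

/-- A triangular map with eight triangles and all valencies 5 or 7. -/
def small57Flags : FlagSystem (Fin 48) := ofTable 48
    [1, 0, 4, 7, 2, 10, 12, 3, 14, 16, 5, 18, 6, 20, 8, 23, 9, 22, 11, 26, 13, 29, 17, 15, 31,
     33, 19, 35, 37, 21, 39, 24, 40, 25, 42, 27, 45, 28, 44, 30, 32, 47, 34, 46, 38, 36, 43, 41]
    [2, 4, 0, 8, 1, 11, 13, 14, 3, 17, 18, 5, 20, 6, 7, 24, 22, 9, 10, 27, 12, 30, 16, 31, 15,
     34, 35, 19, 38, 39, 21, 23, 41, 42, 25, 26, 46, 44, 28, 29, 47, 32, 33, 45, 37, 43, 36, 40]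
    [3, 5, 6, 0, 9, 1, 2, 15, 13, 4, 19, 17, 21, 8, 22, 7, 24, 11, 25, 10, 28, 12, 14, 32, 16,
     18, 36, 34, 20, 31, 38, 29, 23, 43, 27, 44, 26, 46, 30, 41, 45, 39, 47, 33, 35, 40, 37, 42]
    (by decide +kernel)

theorem small57Flags_triangular : small57Flags.toMap.Triangular :=
  small57Flags.toMap_triangular (by decide +kernel) (by decide +kernel)

theorem small57Flags_loopless : small57Flags.toMap.Loopless :=
  small57Flags.toMap_loopless (fun i => List.getD
    [0, 0, 1, 0, 1, 0, 1, 0, 2, 1, 0, 2, 1, 2, 2, 0, 1, 2, 2, 0, 2, 1, 2, 0, 1, 2, 0, 3, 2, 1,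
     3, 1, 0, 2, 3, 3, 0, 2, 3, 3, 0, 3, 3, 2, 3, 0, 2, 3]
    i 0) (by decide +kernel) (by decide +kernel) (by decide +kernel)

/-- A triangular map with twelve triangles and all valencies 5 or 7. -/
def large57Flags : FlagSystem (Fin 72) := ofTable 72
    [1, 0, 4, 7, 2, 10, 12, 3, 14, 16, 5, 18, 6, 20, 8, 23, 9, 25, 11, 28, 13, 31, 33, 15, 35,
     17, 37, 39, 19, 41, 42, 21, 44, 22, 45, 24, 48, 26, 50, 27, 51, 29, 30, 54, 32, 34, 55, 59,
     36, 60, 38, 40, 58, 63, 43, 46, 64, 65, 52, 47, 49, 67, 69, 53, 56, 57, 71, 61, 70, 62, 68,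
     66]
    [2, 4, 0, 8, 1, 11, 13, 14, 3, 17, 18, 5, 20, 6, 7, 24, 25, 9, 10, 29, 12, 32, 34, 35, 15,
     16, 38, 40, 41, 19, 43, 44, 21, 45, 22, 23, 49, 50, 26, 51, 27, 28, 54, 30, 31, 33, 58, 53,
     60, 36, 37, 39, 55, 47, 42, 52, 62, 66, 46, 63, 48, 68, 56, 59, 69, 71, 57, 70, 61, 64, 67,
     65]
    [3, 5, 6, 0, 9, 1, 2, 15, 13, 4, 19, 17, 21, 8, 22, 7, 26, 11, 27, 10, 30, 12, 14, 28, 34,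
     36, 16, 18, 23, 40, 20, 37, 43, 46, 24, 47, 25, 31, 49, 52, 29, 53, 55, 32, 56, 57, 33, 35,
     61, 38, 62, 54, 39, 41, 51, 42, 44, 45, 66, 60, 59, 48, 50, 68, 70, 69, 58, 71, 63, 65, 64,
     67]
    (by decide +kernel)

theorem large57Flags_triangular : large57Flags.toMap.Triangular :=
  large57Flags.toMap_triangular (by decide +kernel) (by decide +kernel)

theorem large57Flags_loopless : large57Flags.toMap.Loopless :=
  large57Flags.toMap_loopless (fun i => List.getD
    [0, 0, 1, 0, 1, 0, 1, 0, 2, 1, 0, 3, 1, 2, 2, 0, 1, 3, 3, 0, 2, 1, 2, 0, 4, 3, 1, 3, 0, 5,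
     2, 1, 5, 2, 4, 4, 3, 1, 4, 3, 5, 5, 2, 5, 5, 4, 2, 4, 3, 4, 4, 5, 3, 5, 5, 2, 5, 4, 3, 4,
     4, 3, 4, 5, 5, 4, 3, 3, 5, 4, 5, 3]
    i 0) (by decide +kernel) (by decide +kernel) (by decide +kernel)

/-- A non-orientable Hurwitz map with six vertices. -/
def hurwitzFlags : FlagSystem (Fin 84) := ofTable 84
    [1, 0, 4, 7, 2, 10, 12, 3, 14, 16, 5, 18, 6, 20, 8, 23, 9, 25, 11, 28, 13, 31, 33, 15, 35,
     17, 38, 40, 19, 42, 44, 21, 36, 22, 47, 24, 32, 50, 26, 52, 27, 54, 29, 45, 30, 43, 58, 34,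
     51, 60, 37, 48, 39, 63, 41, 66, 68, 62, 46, 69, 49, 71, 57, 53, 72, 73, 55, 75, 56, 59, 78,
     61, 64, 65, 77, 67, 80, 74, 70, 83, 76, 82, 81, 79]
    [2, 4, 0, 8, 1, 11, 13, 14, 3, 17, 18, 5, 20, 6, 7, 24, 25, 9, 10, 29, 12, 32, 34, 35, 15,
     16, 39, 41, 42, 19, 45, 36, 21, 47, 22, 23, 31, 51, 52, 26, 54, 27, 28, 44, 43, 30, 49, 33,
     50, 46, 48, 37, 38, 64, 40, 67, 57, 56, 60, 61, 58, 59, 68, 72, 53, 74, 75, 55, 62, 71, 79,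
     69, 63, 77, 65, 66, 82, 73, 83, 70, 81, 80, 76, 78]
    [3, 5, 6, 0, 9, 1, 2, 15, 13, 4, 19, 17, 21, 8, 22, 7, 26, 11, 27, 10, 30, 12, 14, 36, 34,
     37, 16, 18, 43, 41, 20, 46, 45, 48, 24, 49, 23, 25, 53, 51, 55, 29, 56, 28, 57, 32, 31, 59,
     33, 35, 61, 39, 62, 38, 65, 40, 42, 44, 63, 47, 70, 50, 52, 58, 68, 54, 76, 74, 64, 77, 60,
     80, 79, 81, 67, 78, 66, 69, 75, 72, 71, 73, 83, 82]
    (by decide +kernel)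

theorem hurwitzFlags_triangular : hurwitzFlags.toMap.Triangular :=
  hurwitzFlags.toMap_triangular (by decide +kernel) (by decide +kernel)

theorem hurwitzFlags_loopless : hurwitzFlags.toMap.Loopless :=
  hurwitzFlags.toMap_loopless (fun i => List.getD
    [0, 0, 1, 0, 1, 0, 1, 0, 2, 1, 0, 3, 1, 2, 2, 0, 1, 3, 3, 0, 2, 1, 2, 0, 4, 3, 1, 3, 0, 5,
     2, 1, 0, 2, 4, 4, 0, 3, 1, 2, 3, 5, 5, 0, 2, 0, 1, 4, 2, 4, 3, 2, 2, 1, 5, 3, 5, 2, 1, 4,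
     4, 3, 2, 1, 5, 5, 3, 4, 5, 4, 4, 3, 5, 5, 4, 4, 3, 4, 4, 5, 3, 5, 5, 5]
    i 0) (by decide +kernel) (by decide +kernel) (by decide +kernel)

/-! ### Valencies and orientability of the small maps, and the Hurwitz cocycle -/

theorem torusFlags_valencies : torusFlags.toMap.valencies = {6} := by
  rw [torusFlags.toMap_valencies_eq (V := [6]) (by decide) (by decide +kernel) (by decide +kernel)]
  simp

theorem kleinFlags_valencies : kleinFlags.toMap.valencies = {6} := by
  rw [kleinFlags.toMap_valencies_eq (V := [6]) (by decide) (by decide +kernel) (by decide +kernel)]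
  simp

theorem small57Flags_valencies : small57Flags.toMap.valencies = {5, 7} := by
  rw [small57Flags.toMap_valencies_eq (V := [5, 7]) (by decide) (by decide +kernel)
    (by decide +kernel)]
  ext
  simp

theorem large57Flags_valencies : large57Flags.toMap.valencies = {5, 7} := by
  rw [large57Flags.toMap_valencies_eq (V := [5, 7]) (by decide) (by decide +kernel)
    (by decide +kernel)]
  ext
  simp

theorem hurwitzFlags_valencies : hurwitzFlags.toMap.valencies = {7} := by
  rw [hurwitzFlags.toMap_valencies_eq (V := [7]) (by decide) (by decide +kernel)
    (by decide +kernel)]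
  simp

theorem torusFlags_orientable : ¬ torusFlags.toMap.Nonorientable := by
  rw [toMap_not_nonorientable_iff]
  -- The list is a proper 2-colouring of the 36 flags.
  refine ⟨fun i => List.getD
    [0, 1, 1, 1, 0, 0, 0, 0, 0, 1, 1, 1, 1, 1, 1, 1, 0, 0, 0, 0, 0, 0, 0, 0, 0, 1, 1, 1, 1, 1,
     1, 1, 1, 0, 0, 0]
    i 0 == 1, ?_⟩
  decide +kernel

theorem kleinFlags_nonorientable : kleinFlags.toMap.Nonorientable := by
  by_contra h
  obtain ⟨s, ha, hb, hc⟩ := kleinFlags.toMap_not_nonorientable_iff.1 h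
  let F := kleinFlags
  -- A closed walk of odd length nine, along which a proper 2-colouring would change nine times.
  have e : F.c (F.b (F.a (F.c (F.b (F.a (F.c (F.b (F.a 0)))))))) = 0 := by decide +kernel
  have := congrArg s e
  simp only [F, ha, hb, hc] at this
  simp at this

/-- A cocycle of the Hurwitz map with six vertices. -/
def hurwitzCocycle : hurwitzFlags.toMap.Cocycle :=
  let w : Fin 84 → ℤ := fun i => List.getD
    [0, 0, 0, 0, 0, 0, 0, 0, 0, 0, 0, 0, 0, 0, 0, 0, 0, 0, 0, 0, 0, 0, 0, 0, 0, 0, 0, 0, 0, 0,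
     0, 0, 0, 0, 0, 0, 0, 1, 0, 0, 0, 0, 0, 0, 0, 0, 0, 0, -1, 0, -1, 1, 0, 0, 0, 0, -1, -1, 0,
     0, 0, 0, 1, 0, 0, 0, 0, 0, 1, 0, 0, 0, 0, 0, 0, 0, 1, 0, 0, 0, -1, -1, 1, 0]
    i 0
  -- Descent to flag `0` is possible even when edges of nonzero weight may not be crossed.
  have desc : ∀ i : Fin 84, i ≠ 0 → hurwitzFlags.b i < i ∨ hurwitzFlags.c i < i ∨
    hurwitzFlags.a i < i ∧ w (hurwitzFlags.a i) = 0 := by decide +kernel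
  { w := w
    w_α := show ∀ i, w (hurwitzFlags.a i) = -w i by decide +kernel
    w_β := show ∀ i, w (hurwitzFlags.b i) = w i by decide +kernel
    w_vertex := by
      intro x
      have h7 : Function.minimalPeriod hurwitzFlags.toMap.P x = 7 := by
        have : Function.minimalPeriod hurwitzFlags.toMap.P x ∈ hurwitzFlags.toMap.valencies :=
          ⟨x, rfl⟩
        rwa [hurwitzFlags_valencies] at this
      rw [h7]
      clear h7
      revert x
      change ∀ x : Fin 84, ∑ i ∈ Finset.range 7,
        w ((fun j => hurwitzFlags.c (hurwitzFlags.a j))^[i] x) = 0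
      decide +kernel
    base := (0 : Fin 84)
    conn := by
      intro S h0 ha hb hc
      refine forall_mem_of_descent (n := 84) h0 fun i hi => ?_
      rcases desc i hi with h | h | ⟨h, hw⟩
      · exact ⟨_, h, fun hS => hurwitzFlags.b_invol i ▸ hb _ hS⟩
      · refine ⟨_, h, fun hS => ?_⟩
        have := hc _ hS
        rwa [hurwitzFlags.toMap_γ, hurwitzFlags.c_invol i] at this
      · exact ⟨_, h, fun hS => hurwitzFlags.a_invol i ▸ ha _ hS hw⟩
    unit := show ∃ i, w i = 1 by decide +kernel }

open FlagSystem

/-! ### Triangular maps with all valencies five -/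

namespace Pentavalent

/-- The Cayley graph of the full icosahedral group: multiplication by the generators `α`, `β`, `γ`
on the elements, listed in breadth-first order. -/
def tab (s : Fin 3) : Fin 120 → Fin 120 := look 120 (match s with
  | 0 =>
    [1, 0, 4, 7, 2, 10, 12, 3, 14, 16, 5, 18, 6, 20, 8, 23, 9, 25, 11, 28, 13, 31, 33, 15, 35,
     17, 37, 39, 19, 41, 42, 21, 44, 22, 45, 24, 48, 26, 50, 27, 51, 29, 30, 54, 32, 34, 55, 59,
     36, 60, 38, 40, 61, 65, 43, 46, 68, 69, 67, 47, 49, 52, 74, 75, 73, 53, 78, 58, 56, 57, 81,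
     82, 84, 64, 62, 63, 87, 88, 66, 90, 91, 70, 71, 94, 72, 95, 96, 76, 77, 99, 79, 80, 101,
     102, 83, 85, 86, 105, 106, 89, 108, 92, 93, 110, 111, 97, 98, 113, 100, 114, 103, 104, 116,
     107, 109, 117, 112, 115, 119, 118]
  | 1 =>
    [2, 4, 0, 8, 1, 11, 13, 14, 3, 17, 18, 5, 20, 6, 7, 24, 25, 9, 10, 29, 12, 32, 34, 35, 15,
     16, 38, 40, 41, 19, 43, 44, 21, 45, 22, 23, 49, 50, 26, 51, 27, 28, 54, 30, 31, 33, 58, 53,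
     60, 36, 37, 39, 64, 47, 42, 67, 62, 70, 46, 65, 48, 73, 56, 76, 52, 59, 79, 55, 74, 81, 57,
     83, 85, 61, 68, 87, 63, 89, 90, 66, 92, 69, 94, 71, 95, 72, 97, 75, 99, 77, 78, 101, 80,
     103, 82, 84, 105, 86, 107, 88, 109, 91, 110, 93, 112, 96, 113, 98, 114, 100, 102, 116, 104,
     106, 108, 118, 111, 119, 115, 117]
  | 2 =>
    [3, 5, 6, 0, 9, 1, 2, 15, 13, 4, 19, 17, 21, 8, 22, 7, 26, 11, 27, 10, 30, 12, 14, 28, 34,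
     36, 16, 18, 23, 40, 20, 37, 43, 46, 24, 47, 25, 31, 49, 52, 29, 53, 55, 32, 56, 57, 33, 35,
     61, 38, 62, 63, 39, 41, 66, 42, 44, 45, 70, 71, 72, 48, 50, 51, 76, 77, 54, 79, 80, 82, 58,
     59, 60, 85, 86, 88, 64, 65, 91, 67, 68, 93, 69, 89, 96, 73, 74, 98, 75, 83, 100, 78, 97,
     81, 103, 104, 84, 92, 87, 107, 90, 109, 108, 94, 95, 112, 111, 99, 102, 101, 115, 106, 105,
     117, 118, 110, 119, 113, 114, 116])

/-- For each element other than `1` and the central involution `119`, an element whose left product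
with it, or with its square, shows that the two cannot be identified. -/
def witness : Fin 120 → Fin 120 := look 120
    [0, 0, 0, 0, 0, 0, 0, 0, 0, 29, 1, 24, 24, 2, 29, 3, 1, 2, 1, 0, 2, 8, 3, 0, 8, 4, 39, 31,
     5, 33, 11, 33, 6, 31, 11, 39, 29, 11, 2, 5, 24, 11, 24, 6, 2, 29, 7, 7, 8, 23, 9, 8, 12,
     16, 23, 16, 10, 14, 10, 12, 9, 10, 12, 23, 16, 10, 8, 12, 16, 23, 8, 15, 29, 7, 7, 18, 24,
     2, 24, 20, 11, 29, 2, 11, 11, 31, 39, 11, 19, 33, 31, 33, 21, 22, 39, 25, 8, 0, 2, 8, 1, 0,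
     2, 1, 29, 26, 27, 24, 24, 30, 29, 0, 0, 0, 0, 45, 36, 47, 46, 0]

theorem tab_tab : ∀ s i, tab s (tab s i) = i := by decide +kernel

/-- The first letter of the word of an element. -/
def parent (i : Fin 120) : Fin 3 := if tab 0 i < i then 0 else if tab 1 i < i then 1 else 2

/-- A word of length at most `k` for an element. -/
def word : ℕ → Fin 120 → List (Fin 3)
  | 0, _ => []
  | k + 1, i => if i = 0 then [] else parent i :: word k (tab (parent i) i)

def act (w : List (Fin 3)) (i : Fin 120) : Fin 120 := w.foldr tab i

theorem act_reverse_act (w : List (Fin 3)) (i : Fin 120) : act w.reverse (act w i) = i := by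
  induction w generalizing i with
  | nil => rfl
  | cons s w ih =>
    simp only [act, List.reverse_cons, List.foldr_append, List.foldr_cons, List.foldr_nil, tab_tab]
    exact ih i

theorem act_act_reverse (w : List (Fin 3)) (i : Fin 120) : act w (act w.reverse i) = i := by
  have := act_reverse_act w.reverse i
  rwa [List.reverse_reverse] at this

/-- 15 is the length of the longest element of the Coxeter group H₃, so words of length 15 reach all
120 elements. -/
theorem act_word : ∀ i, act (word 15 i) 0 = i := by decide +kernel

/-- Edges of the Cayley graph that belong to the tree of words have rank zero; the others are ranked
by their second end. -/
def rank (s : Fin 3) (i : Fin 120) : ℕ :=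
  if parent (max i (tab s i)) = s then 0 else (max i (tab s i)).val

theorem word_of_rank_eq_zero : ∀ s i, rank s i = 0 →
    word 15 (tab s i) = s :: word 15 i ∨ word 15 i = s :: word 15 (tab s i) := by decide +kernel

/-- An alternating path of length `k` from `i` to `j`, starting with `t`, all of whose edges have
rank less than `r`. -/
def lowPath (r : ℕ) : Fin 3 → Fin 3 → ℕ → Fin 120 → Fin 120 → Bool
  | _, _, 0, i, j => i == j
  | s, t, k + 1, i, j => decide (rank t i < r) && lowPath r t s k (tab t i) j

/-- The orders of the products of two generators are `halfOrder s t + 1`. -/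
def halfOrder (s t : Fin 3) : ℕ := if s + t = 1 then 1 else if s + t = 2 then 4 else 2

/-- Every edge outside the tree closes a relator polygon whose other edges come earlier: the
combinatorial form of simple connectedness of the Cayley complex. If `st` has order `m`, the polygon
has `2m` sides, and `2 * halfOrder s t + 1 = 2m - 1` remain without the given edge. -/
theorem exists_lowPath : ∀ s i, rank s i = 0 ∨ ∃ t, t ≠ s ∧
    lowPath (rank s i) s t (2 * halfOrder s t + 1) i (tab s i) = true := by decide +kernel

/-- Two distinct flags in the same vertex, edge or face. -/
def conflict (p q : Fin 120) : Bool :=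
  [[0], [1], [2], [0, 1], [2, 0], [2, 0, 2, 0], [2, 0, 2, 0, 2, 0], [2, 0, 2, 0, 2, 0, 2, 0],
    [2, 1], [2, 1, 2, 1]].any fun w => act w p == q

/-- Reflections and nontrivial rotations are conjugate to words in `conflict`. The remaining
noncentral elements are rotary reflections of order 6 or 10, whose squares are nontrivial rotations.
The witness is the conjugating element. -/
theorem conflict_of_ne : ∀ y, y = 0 ∨ y = 119 ∨
    conflict (witness y) (act (word 15 (witness y)) y) = true ∨
    conflict (witness y) (act (word 15 (witness y)) (act (word 15 y) y)) = true := by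
  decide +kernel

variable (M : TutteMap)

/-- The three involutions of a map. -/
def gen : Fin 3 → Perm M.X
  | 0 => M.α
  | 1 => M.β
  | 2 => M.γ

def actOn (w : List (Fin 3)) (x : M.X) : M.X := w.foldr (fun s => gen M s) x

theorem gen_gen (s : Fin 3) (x : M.X) : gen M s (gen M s x) = x := by
  fin_cases s
  · exact M.α_invol x
  · exact M.β_invol x
  · exact M.γ_invol x

/-- Apply `k` generators, alternating between `t` and `s` and starting with `t`. -/
def alternate : Fin 3 → Fin 3 → ℕ → M.X → M.X
  | _, _, 0, x => x
  | s, t, k + 1, x => alternate t s k (gen M t x)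

theorem alternate_odd (s t : Fin 3) (k : ℕ) (x : M.X) :
    alternate M s t (2 * k + 1) x = gen M t (((gen M s * gen M t) ^ k) x) := by
  induction k generalizing x with
  | zero => rfl
  | succ k ih =>
    rw [pow_succ, Perm.mul_apply, ← ih]
    rfl

variable {M}

/-- A map from the flags of the icosahedron to the flags of a map. -/
def develop (x₀ : M.X) (i : Fin 120) : M.X := actOn M (word 15 i) x₀

theorem period_five (h5 : M.valencies = {5}) (x : M.X) : Function.minimalPeriod M.P x = 5 := by
  have : Function.minimalPeriod M.P x ∈ M.valencies := ⟨x, rfl⟩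
  rwa [h5] at this

/-- These are the Coxeter relations of the full icosahedral group. -/
theorem gen_pow (ht : M.Triangular) (h5 : M.valencies = {5}) {s t : Fin 3}
    (h : t ≠ s) : (gen M s * gen M t) ^ (halfOrder s t + 1) = 1 := by
  have hinv : ∀ s, (gen M s)⁻¹ = gen M s := fun s => by
    rw [inv_eq_iff_mul_eq_one]; ext1 x; exact gen_gen M s x
  have hsymm : ∀ s t n, (gen M s * gen M t) ^ n = 1 → (gen M t * gen M s) ^ n = 1 := by
    intro s t n h
    rw [← inv_inj, inv_one, ← inv_pow, mul_inv_rev, hinv, hinv, h]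
  have h01 : (gen M 0 * gen M 1) ^ 2 = 1 := by
    ext1 x
    change M.α (M.β (M.α (M.β x))) = x
    rw [M.α_β_comm, M.α_invol, M.β_invol]
  have h21 : (gen M 2 * gen M 1) ^ 3 = 1 := by
    ext1 x
    exact ht.γβ_cube x
  have h20 : (gen M 2 * gen M 0) ^ 5 = 1 := by
    have e : gen M 2 * gen M 0 = M.P := by
      ext1 x
      exact (M.P_apply x).symm
    ext1 x
    have := Function.isPeriodicPt_minimalPeriod M.P x
    rw [period_five h5] at this
    rw [e, ← Perm.iterate_eq_pow]
    exact this
  fin_cases s <;> fin_cases t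
  · exact absurd rfl h
  · exact h01
  · exact hsymm _ _ _ h20
  · exact hsymm _ _ _ h01
  · exact absurd rfl h
  · exact hsymm _ _ _ h21
  · exact h20
  · exact h21
  · exact absurd rfl h

theorem alternate_eq (ht : M.Triangular) (h5 : M.valencies = {5}) {s t : Fin 3}
    (h : t ≠ s) (x : M.X) :
    alternate M s t (2 * halfOrder s t + 1) x = gen M s x := by
  have := Perm.congr_fun (gen_pow ht h5 h) x
  rw [pow_succ', Perm.mul_apply, Perm.mul_apply, ← alternate_odd, Perm.one_apply] at this
  conv_rhs => rw [← this]
  rw [gen_gen]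

/-- Equivariance holds by definition along the tree of words. For any other edge it follows by
induction on rank: the rest of a relator polygon is already respected, and the relator holds in `M`.
-/
theorem gen_develop (ht : M.Triangular) (h5 : M.valencies = {5})
    (x₀ : M.X) (s : Fin 3) (i : Fin 120) :
    gen M s (develop x₀ i) = develop x₀ (tab s i) := by
  suffices H : ∀ r s i, rank s i = r → gen M s (develop x₀ i) = develop x₀ (tab s i) from H _ s i rfl
  intro r
  induction r using Nat.strong_induction_on with
  | _ r ih =>
    intro s i hr
    rcases exists_lowPath s i with h0 | ⟨t, hts, hp⟩
    · rcases word_of_rank_eq_zero s i h0 with h | h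
      · rw [develop, develop, h]
        rfl
      · have : develop x₀ i = gen M s (develop x₀ (tab s i)) := by
          rw [develop, develop, h]
          rfl
        rw [this, gen_gen]
    · rw [hr] at hp
      rw [← alternate_eq ht h5 hts]
      have key : ∀ k s t i j, lowPath r s t k i j = true →
          alternate M s t k (develop x₀ i) = develop x₀ j := by
        intro k
        induction k with
        | zero =>
          intro s t i j h
          simp only [lowPath, beq_iff_eq] at h
          rw [h]
          rfl
        | succ k ihk =>
          intro s t i j h
          simp only [lowPath, Bool.and_eq_true, decide_eq_true_eq] at h
          rw [alternate, ih _ h.1 t i rfl]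
          exact ihk _ _ _ _ h.2
      exact key _ _ _ _ _ hp

theorem actOn_develop (ht : M.Triangular) (h5 : M.valencies = {5})
    (x₀ : M.X) (w : List (Fin 3)) (i : Fin 120) :
    actOn M w (develop x₀ i) = develop x₀ (act w i) := by
  induction w with
  | nil => rfl
  | cons s w ih =>
    change gen M s (actOn M w (develop x₀ i)) = _
    rw [ih, gen_develop ht h5]
    rfl

theorem develop_surjective (ht : M.Triangular) (h5 : M.valencies = {5})
    (x₀ : M.X) : Function.Surjective (develop x₀) := by
  have hg : ∀ s, ∀ x ∈ Set.range (develop x₀), gen M s x ∈ Set.range (develop x₀) := by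
    rintro s _ ⟨i, rfl⟩
    exact ⟨_, (gen_develop ht h5 x₀ s i).symm⟩
  exact M.forall_mem (S := Set.range (develop x₀)) ⟨0, rfl⟩ (hg 0) (hg 1) (hg 2)

theorem develop_ne_of_conflict (ht : M.Triangular) (h5 : M.valencies = {5})
    (x₀ : M.X) {p q : Fin 120} (h : conflict p q = true) :
    develop x₀ p ≠ develop x₀ q := by
  have hP : ∀ x, ∀ k < 5, 0 < k → M.P^[k] x ≠ x := by
    intro x k hk hk' h
    have := Function.IsPeriodicPt.minimalPeriod_le hk' h
    rw [period_five h5] at this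
    omega
  have hP' : ∀ x, M.γ (M.α x) = M.P x := fun x => (M.P_apply x).symm
  simp only [conflict, List.any_cons, List.any_nil, Bool.or_false, Bool.or_eq_true,
    beq_iff_eq] at h
  intro e
  rcases h with h | h | h | h | h | h | h | h | h | h <;>
    rw [← h, ← actOn_develop ht h5] at e <;> generalize develop x₀ p = x at e <;>
    replace e := e.symm
  · exact M.α_free x e
  · exact M.β_free x e
  · exact M.γ_free x e
  · exact M.αβ_free x e
  · exact hP x 1 (by decide) (by decide) ((hP' x).symm.trans e)
  · refine hP x 2 (by decide) (by decide) (Eq.trans ?_ e)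
    simp [actOn, gen, hP']
  · refine hP x 3 (by decide) (by decide) (Eq.trans ?_ e)
    simp [actOn, gen, hP']
  · refine hP x 4 (by decide) (by decide) (Eq.trans ?_ e)
    simp [actOn, gen, hP']
  · exact ht.γβ_free x e
  -- Since `γβ` has cube 1, a flag fixed by its square is fixed by `γβ`.
  · refine ht.γβ_free x ?_
    have h3 := ht.γβ_cube x
    change M.γ (M.β (M.γ (M.β x))) = x at e
    exact (congrArg (fun y => M.γ (M.β y)) e).symm.trans h3

/-- If `y` fixes `x₀`, so does its square, and `p`, `p * y` and `p * y * y` develop to the same flag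
for every `p`. `conflict_of_ne` forbids this unless `y` is central. -/
theorem eq_or_eq_of_develop_eq (ht : M.Triangular) (h5 : M.valencies = {5})
    (x₀ : M.X) {y : Fin 120} (h : develop x₀ 0 = develop x₀ y) :
    y = 0 ∨ y = 119 := by
  have hne : ∀ z, develop x₀ 0 = develop x₀ z → ∀ p, conflict p (act (word 15 p) z) ≠ true := by
    intro z hz p hc
    refine develop_ne_of_conflict ht h5 x₀ hc ?_
    rw [← actOn_develop ht h5, ← hz, actOn_develop ht h5, act_word]
  rcases conflict_of_ne y with h' | h' | h' | h'
  · exact Or.inl h'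
  · exact Or.inr h'
  · exact absurd h' (hne y h _)
  · refine absurd h' (hne _ ?_ _)
    rw [← actOn_develop ht h5, ← h, actOn_develop ht h5, act_word, h]

/-- The fibres of `develop` are the left cosets of the stabiliser of `x₀`, which is trivial or
generated by the central involution `119`. -/
theorem develop_eq_iff (ht : M.Triangular) (h5 : M.valencies = {5})
    (x₀ : M.X) (i j : Fin 120) : develop x₀ i = develop x₀ j ↔
    j = i ∨ develop x₀ 0 = develop x₀ 119 ∧ j = act (word 15 i) 119 := by
  constructor
  · intro h
    have h0 : develop x₀ 0 = develop x₀ (act (word 15 i).reverse j) := by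
      have h' := act_reverse_act (word 15 i) 0
      rw [act_word] at h'
      rw [← actOn_develop ht h5, ← h, actOn_develop ht h5, h']
    have hj : j = act (word 15 i) (act (word 15 i).reverse j) := (act_act_reverse _ _).symm
    rcases eq_or_eq_of_develop_eq ht h5 x₀ h0 with e | e
    · rw [e, act_word] at hj
      exact Or.inl hj
    · rw [e] at h0 hj
      exact Or.inr ⟨h0, hj⟩
  · rintro (rfl | ⟨h, rfl⟩)
    · rfl
    · rw [← actOn_develop ht h5, ← h, actOn_develop ht h5, act_word]

/-- Triangular maps of valency five are isomorphic if they agree on whether antipodal flags of the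
icosahedron are identified. -/
theorem iso_of_iff {M N : TutteMap} (hM : M.Triangular) (hM5 : M.valencies = {5})
    (hN : N.Triangular) (hN5 : N.valencies = {5}) (x₀ : M.X) (y₀ : N.X)
    (h : develop x₀ 0 = develop x₀ 119 ↔ develop y₀ 0 = develop y₀ 119) : M.Iso N := by
  have hker : ∀ i j, develop x₀ i = develop x₀ j ↔ develop y₀ i = develop y₀ j := by
    intro i j
    rw [develop_eq_iff hM hM5, develop_eq_iff hN hN5, h]
  have hsM := develop_surjective hM hM5 x₀
  have hsN := develop_surjective hN hN5 y₀
  choose f hf using hsM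
  let ξ : M.X → N.X := fun x => develop y₀ (f x)
  have hξ : ∀ i, ξ (develop x₀ i) = develop y₀ i := fun i => (hker _ _).1 (hf _)
  have hbij : Function.Bijective ξ := by
    constructor
    · intro x x' e
      rw [← hf x, ← hf x']
      exact (hker _ _).2 e
    · intro y
      obtain ⟨i, rfl⟩ := hsN y
      exact ⟨_, hξ i⟩
  have hgen : ∀ s x, ξ (gen M s x) = gen N s (ξ x) := by
    intro s x
    rw [← hf x, gen_develop hM hM5, hξ, hξ, gen_develop hN hN5]
  exact TutteMap.iso_of_commute (Equiv.ofBijective ξ hbij) (hgen 0) (hgen 1) (hgen 2)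

/-- There are at most two triangular maps with all valencies five. -/
theorem iso_or_iso {M N L : TutteMap} (hM : M.Triangular) (hM5 : M.valencies = {5})
    (hN : N.Triangular) (hN5 : N.valencies = {5}) (hL : L.Triangular) (hL5 : L.valencies = {5})
    (hNL : ¬ N.Iso L) : M.Iso N ∨ M.Iso L := by
  obtain ⟨x⟩ := M.nonempty
  obtain ⟨y⟩ := N.nonempty
  obtain ⟨z⟩ := L.nonempty
  -- One truth value determines the class, and it differs for `N` and `L`; that of `M` agrees with
  -- one of them.
  by_contra! hcon
  have h1 := fun h => hcon.1 (iso_of_iff hM hM5 hN hN5 x y h)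
  have h2 := fun h => hcon.2 (iso_of_iff hM hM5 hL hL5 x z h)
  have h3 := fun h => hNL (iso_of_iff hN hN5 hL hL5 y z h)
  tauto

end Pentavalent

/-! ### The icosahedron and its quotient -/

namespace TriComplex

variable (K : TriComplex) (hne : Nonempty K.Flag)
  (hc : ∀ x y, ∃ g ∈ Subgroup.closure {K.flipFace, K.flipVertex, K.flipEdge * K.flipFace}, g x = y)

theorem toMap_γ (x : K.Flag) : (K.toMap hne hc).γ x = K.flipEdge x :=
  congrArg K.flipEdge (K.flipFace_flipFace x)

theorem toMap_loopless : (K.toMap hne hc).Loopless :=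
  TutteMap.loopless_of_label (M := K.toMap hne hc) (fun x : K.Flag => x.1.1) (fun _ => rfl)
    (fun x => (congrArg (fun y : K.Flag => y.1.1) (K.toMap_γ hne hc x)).trans rfl)
    fun x h => K.ne12 _ _ _ x.2 h.symm

theorem toMap_triangular : (K.toMap hne hc).Triangular := by
  intro x
  have e : ∀ x : K.Flag, ((K.toMap hne hc).P * (K.toMap hne hc).α * (K.toMap hne hc).β) x =
      K.flipEdge (K.flipVertex x) := fun x => K.toMap_γ hne hc _
  refine minimalPeriod_eq_three ?_ ?_
  · rw [e x, e, e]
    rfl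
  · rw [e x]
    exact fun h => K.ne12 _ _ _ x.2 (congrArg (fun y : K.Flag => y.1.1) h).symm

/-- As 5 is prime, it is enough that the fifth iterate of the rotation is the identity and that one
step moves every flag. -/
theorem toMap_valencies (h5 : ∀ a b c, K.T a b c →
    (fun t : K.V × K.V × K.V => (t.1, K.op t.1 t.2.1 t.2.2, t.2.1))^[5] (a, b, c) = (a, b, c))
    (h1 : ∀ a b c, K.T a b c → K.op a b c ≠ b) : (K.toMap hne hc).valencies = {5} := by
  have hit : ∀ (k : ℕ) (x : K.Flag), ((K.flipEdge * K.flipFace : Perm K.Flag)^[k] x).1 =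
      (fun t : K.V × K.V × K.V => (t.1, K.op t.1 t.2.1 t.2.2, t.2.1))^[k] x.1 := by
    intro k
    induction k with
    | zero => intro x; rfl
    | succ k ih =>
      intro x
      rw [Function.iterate_succ_apply, Function.iterate_succ_apply]
      exact ih _
  have key : ∀ x : K.Flag, Function.minimalPeriod (K.flipEdge * K.flipFace : Perm K.Flag) x = 5 :=
    have := Fact.mk Nat.prime_five
    fun x => Function.minimalPeriod_eq_prime (p := 5)
      (Subtype.ext ((hit 5 x).trans (h5 _ _ _ x.2)))
      fun h => h1 _ _ _ x.2 (congrArg (fun y : K.Flag => y.1.2.1) h)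
  ext m
  constructor
  · rintro ⟨x, rfl⟩
    exact key x
  · rintro rfl
    exact ⟨hne.some, key _⟩

end TriComplex

theorem O20_loopless : O20.Loopless := TriComplex.toMap_loopless _ _ _
theorem P10_loopless : P10.Loopless := TriComplex.toMap_loopless _ _ _
theorem O20_triangular : O20.Triangular := TriComplex.toMap_triangular _ _ _
theorem P10_triangular : P10.Triangular := TriComplex.toMap_triangular _ _ _

set_option synthInstance.maxHeartbeats 400000 in
set_option synthInstance.maxSize 1000 in
open Icosahedron in
theorem O20_valencies : O20.valencies = {5} := by
  apply TriComplex.toMap_valencies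
  · change ∀ a b c : Vert, face a b c →
      (fun t : Vert × Vert × Vert => (t.1, findOther verts face t.1 t.2.1 t.2.2, t.2.1))^[5]
        (a, b, c) = (a, b, c)
    decide +kernel
  · change ∀ a b c : Vert, face a b c → findOther verts face a b c ≠ b
    decide +kernel

open Icosahedron in
theorem P10_valencies : P10.valencies = {5} := by
  apply TriComplex.toMap_valencies
  · change ∀ a b c : Option (Fin 5), projFace a b c →
      (fun t : Option (Fin 5) × Option (Fin 5) × Option (Fin 5) =>
        (t.1, findOther projVerts projFace t.1 t.2.1 t.2.2, t.2.1))^[5]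
        (a, b, c) = (a, b, c)
    decide +kernel
  · change ∀ a b c : Option (Fin 5), projFace a b c → findOther projVerts projFace a b c ≠ b
    decide +kernel

theorem O20_card : Nat.card O20.X = 120 := by
  change Nat.card {t : Icosahedron.Vert × Icosahedron.Vert × Icosahedron.Vert //
    Icosahedron.face t.1 t.2.1 t.2.2} = 120
  rw [Nat.card_eq_fintype_card]
  decide +kernel

theorem P10_card : Nat.card P10.X = 60 := by
  change Nat.card {t : Option (Fin 5) × Option (Fin 5) × Option (Fin 5) //
    Icosahedron.projFace t.1 t.2.1 t.2.2} = 60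
  rw [Nat.card_eq_fintype_card]
  decide +kernel

theorem O20_not_iso_P10 : ¬ O20.Iso P10 := by
  intro h
  have := h.card_eq
  rw [O20_card, P10_card] at this
  exact absurd this (by decide)

/-! ### Closed s-manifolds and their maps -/

namespace Glue

variable {F : Type}

/-- Every permutation of three corners is a product of the transpositions of consecutive corners. -/
theorem perm_induction {p : Perm (Fin 3) → Prop} (h1 : p 1) (h01 : ∀ π, p π → p (π * swap 0 1))
    (h12 : ∀ π, p π → p (π * swap 1 2)) (π : Perm (Fin 3)) : p π := by
  have key : ∀ σ : Perm (Fin 3), σ = 1 ∨ σ = 1 * swap 0 1 ∨ σ = 1 * swap 1 2 ∨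
      σ = 1 * swap 0 1 * swap 1 2 ∨ σ = 1 * swap 1 2 * swap 0 1 ∨
      σ = 1 * swap 0 1 * swap 1 2 * swap 0 1 := by decide
  rcases key π with rfl | rfl | rfl | rfl | rfl | rfl
  · exact h1
  · exact h01 _ h1
  · exact h12 _ h1
  · exact h12 _ (h01 _ h1)
  · exact h01 _ (h12 _ h1)
  · exact h01 _ (h12 _ (h01 _ h1))

theorem start_turn (z : Side F) : start (turn z) = start z := by
  refine Prod.ext rfl ?_
  change (z.2 * swap 1 2 : Perm (Fin 3)) 0 = z.2 0
  rw [Perm.mul_apply]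
  rfl

theorem eq_or_eq_turn {z w : Side F} (h : start w = start z) : w = z ∨ w = turn z := by
  obtain ⟨f, π⟩ := z
  obtain ⟨g, τ⟩ := w
  obtain ⟨rfl, h2⟩ := Prod.mk.inj h
  have key : ∀ π τ : Perm (Fin 3), τ 0 = π 0 → τ = π ∨ τ = π * swap 1 2 := by decide
  rcases key π τ h2 with rfl | rfl
  · exact Or.inl rfl
  · exact Or.inr rfl

/-- Provides one chosen directed side starting at each corner. -/
theorem start_swap (c : F × Fin 3) : start (c.1, swap 0 c.2) = c :=
  Prod.ext rfl (swap_apply_left 0 c.2)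

theorem start_rev_ne (z : Side F) : start (rev z) ≠ start z := by
  obtain ⟨f, π⟩ := z
  intro h
  have h2 : (π * swap 0 1 : Perm (Fin 3)) 0 = π 0 := congrArg Prod.snd h
  rw [Perm.mul_apply, swap_apply_left] at h2
  exact absurd (π.injective h2) (by decide)

/-- The directed sides that start at a vertex. -/
def vertexSides (glue : Perm (Side F)) (z : Side F) : Set (Side F) :=
  orbitSet {turn * glue, glue} z

variable (glue : Perm (Side F))

theorem vertexSides_glue (z : Side F) : vertexSides glue (glue z) = vertexSides glue z :=
  orbitSet_apply (Subgroup.subset_closure (by simp)) z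

theorem vertexSides_turn (z : Side F) : vertexSides glue (turn z) = vertexSides glue z := by
  have h1 : turn * glue ∈ Subgroup.closure {turn * glue, glue} :=
    Subgroup.subset_closure (by simp)
  have h2 : glue ∈ Subgroup.closure {turn * glue, glue} := Subgroup.subset_closure (by simp)
  refine orbitSet_apply (g := turn) ?_ z
  simpa using mul_mem h1 (inv_mem h2)

theorem mem_vertexSides_self (z : Side F) : z ∈ vertexSides glue z := mem_orbitSet_self _ _

theorem vertexSides_eq_of_mem {z w : Side F} (h : w ∈ vertexSides glue z) :
    vertexSides glue w = vertexSides glue z := by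
  obtain ⟨g, hg, rfl⟩ := h
  exact orbitSet_apply hg z

/-- Two directed sides start at the same corner exactly when they are equal or exchanged by `turn`,
and `turn` and `glue` generate the group whose orbits are `vertexSides`. -/
theorem sameVertex_iff (z : Side F) (d : F × Fin 3) :
    SameVertex glue (start z) d ↔ ∃ w ∈ vertexSides glue z, start w = d := by
  constructor
  · intro h
    have hV : ∀ z w : Side F, start w = start z → w ∈ vertexSides glue z := by
      intro z w h
      rcases eq_or_eq_turn h with rfl | rfl
      · exact mem_vertexSides_self _ _
      · rw [← vertexSides_turn]
        exact mem_vertexSides_self _ _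
    have key : ∀ c d, SameVertex glue c d →
        ∀ z : Side F, start z = c → ∃ w ∈ vertexSides glue z, start w = d := by
      intro c d h
      induction h with
      | rel c d h =>
        obtain ⟨y, rfl, rfl⟩ := h
        intro z hz
        refine ⟨glue y, ?_, rfl⟩
        rw [← vertexSides_eq_of_mem glue (hV z y hz.symm), ← vertexSides_glue]
        exact mem_vertexSides_self _ _
      | refl c => exact fun z hz => ⟨z, mem_vertexSides_self _ _, hz⟩
      | symm c d _ ih =>
        intro z hz
        obtain ⟨w, hw, hwz⟩ := ih (c.1, swap 0 c.2) (start_swap c)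
        have h2 := hV z w (hwz.trans hz.symm)
        refine ⟨(c.1, swap 0 c.2), ?_, start_swap c⟩
        rw [← vertexSides_eq_of_mem glue h2, vertexSides_eq_of_mem glue hw]
        exact mem_vertexSides_self _ _
      | trans c d e _ _ ih1 ih2 =>
        intro z hz
        obtain ⟨w, hw, hwd⟩ := ih1 z hz
        obtain ⟨y, hy, hye⟩ := ih2 w hwd
        exact ⟨y, vertexSides_eq_of_mem glue hw ▸ hy, hye⟩
    exact key _ _ h z rfl
  · rintro ⟨_, ⟨g, hg, rfl⟩, rfl⟩
    have key : SameVertex glue (start z) (start (g z)) = SameVertex glue (start z) (start z) := by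
      refine label_eq_of_mem_closure (v := fun w => SameVertex glue (start z) (start w)) ?_ hg z
      have hglue : ∀ w, SameVertex glue (start w) (start (glue w)) :=
        fun w => Relation.EqvGen.rel _ _ ⟨w, rfl, rfl⟩
      have hα : ∀ w, SameVertex glue (start z) (start (glue w)) =
          SameVertex glue (start z) (start w) := fun w => propext
        ⟨fun h => h.trans _ _ _ ((hglue w).symm _ _), fun h => h.trans _ _ _ (hglue w)⟩
      rintro k (rfl | rfl) w
      · rw [Perm.mul_apply, start_turn, hα]
      · exact hα w
    rw [key]
    exact Relation.EqvGen.refl _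

variable {glue}

/-- The number of corners at a vertex is its valency. -/
theorem ncard_sameVertex [Finite F] (ha : ∀ z, glue (glue z) = z)
    (hQ : glue * (turn * glue) = (turn * glue)⁻¹ * glue)
    (hb : ∀ (z : Side F) (k : ℤ), ((turn * glue : Perm (Side F)) ^ k) z ≠ glue z) (z : Side F) :
    Set.ncard {d | SameVertex glue (start z) d} =
      Function.minimalPeriod (turn * glue : Perm (Side F)) z := by
  set Q : Perm (Side F) := turn * glue with hQdef
  have hturn : ∀ y, turn y = Q (glue y) := fun y => by rw [hQdef, Perm.mul_apply, ha]
  have himg : {d | SameVertex glue (start z) d} =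
      (fun i => start (Q^[i] z)) '' Set.Iio (Function.minimalPeriod Q z) := by
    ext d
    rw [Set.mem_ofPred_eq, sameVertex_iff]
    constructor
    · rintro ⟨w, hw, rfl⟩
      obtain ⟨k, hk⟩ := (mem_orbitSet_dihedral ha hQ z w).1 hw
      have : ∃ k : ℤ, start w = start ((Q ^ k) z) := by
        rcases hk with rfl | rfl
        · exact ⟨k, rfl⟩
        · refine ⟨k + 1, ?_⟩
          rw [add_comm, zpow_add, zpow_one, Perm.mul_apply]
          exact (start_turn _).symm
      obtain ⟨k, hk⟩ := this
      obtain ⟨i, hi, h⟩ := exists_lt_minimalPeriod Q z k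
      exact ⟨i, hi, by rw [hk, h]⟩
    · rintro ⟨i, -, rfl⟩
      refine ⟨_, (mem_orbitSet_dihedral ha hQ z _).2 ⟨i, Or.inl rfl⟩, ?_⟩
      simp only [zpow_natCast, Perm.iterate_eq_pow]
  rw [himg, Set.InjOn.ncard_image, ← Finset.coe_Iio, Set.ncard_coe_finset, Nat.card_Iio]
  -- Equal corners leave two cases: equal sides give `i = j`, and sides exchanged by `turn` would
  -- put `glue` of a side into its own `Q`-cycle, against `hb`.
  intro i hi j hj h
  rcases eq_or_eq_turn h with e | e
  · exact Function.iterate_injOn_Iio_minimalPeriod hi hj e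
  · exfalso
    refine hb (Q^[j] z) (-1 + i - j) ?_
    rw [hturn] at e
    rw [← Q.injective.eq_iff, ← e]
    have hk : Q * (Q ^ (-1 + i - j : ℤ) * Q ^ j) = Q ^ i := by
      rw [← zpow_natCast, ← zpow_natCast, ← zpow_add, ← zpow_one_add]
      congr 1
      ring
    simp only [Perm.iterate_eq_pow]
    exact Perm.congr_fun hk z

end Glue

namespace ClosedSManifold

open Glue

instance (S : ClosedSManifold) : Finite S.F := S.finite

section toMap

variable (S : ClosedSManifold)

theorem toMap_γ (z : Side S.F) : S.toMap.γ z = turn z :=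
  congrArg turn (S.glue_invol z)

theorem triangular_toMap : S.toMap.Triangular := by
  have e : ∀ z : Side S.F, (S.toMap.P * S.toMap.α * S.toMap.β) z = turn (rev z) :=
    fun z => S.toMap_γ _
  have h1 : ∀ π : Perm (Fin 3),
      π * swap 0 1 * swap 1 2 * swap 0 1 * swap 1 2 * swap 0 1 * swap 1 2 = π := by decide
  have h2 : ∀ π : Perm (Fin 3), π * swap 0 1 * swap 1 2 ≠ π := by decide
  intro z
  refine minimalPeriod_eq_three ?_ ?_
  · rw [e z, e, e]
    exact Prod.ext rfl (h1 z.2)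
  · rw [e z]
    exact fun h => h2 z.2 (congrArg Prod.snd h)

/-- A loop would identify two corners of one disk. -/
theorem loopless_toMap : S.toMap.Loopless := by
  intro z h
  have h2 : SameVertex S.glue (start z) (start (rev z)) := (sameVertex_iff S.glue z _).2 ⟨_, h, rfl⟩
  exact start_rev_ne z (Prod.ext rfl (S.vertex_distinct _ _ _ h2).symm)

theorem valencies_toMap : S.toMap.valencies ⊆ {5, 6, 7} := by
  rintro _ ⟨z, rfl⟩
  have := S.vertex_disks (start z)
  rw [ncard_sameVertex S.glue_invol S.toMap.α_P S.toMap.basic z] at this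
  exact this

theorem faceCount_toMap : S.toMap.faceCount = Nat.card S.F := by
  have h : S.toMap.faceCount * 6 = Nat.card (S.F × Perm (Fin 3)) := S.triangular_toMap.faceCount_mul
  rw [Nat.card_prod, Nat.card_perm, Nat.card_fin] at h
  exact Nat.eq_of_mul_eq_mul_right (by decide) h

end toMap

/-- Closed s-manifolds with isomorphic maps are isomorphic. -/
theorem iso_of_toMap_iso {S T : ClosedSManifold} (h : S.toMap.Iso T.toMap) : S.Iso T := by
  obtain ⟨ξ, h⟩ := h
  change Side S.F ≃ Side T.F at ξ
  have hα : ∀ z, ξ (S.glue z) = T.glue (ξ z) := fun z => (h z).1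
  have hβ : ∀ z, ξ (rev z) = rev (ξ z) := fun z => (h z).2.1
  have hγ : ∀ z, ξ (turn z) = turn (ξ z) := by
    intro z
    have h3 : ξ (turn (S.glue (S.glue z))) = turn (T.glue (ξ (S.glue z))) := (h (S.glue z)).2.2
    rwa [S.glue_invol, hα, T.glue_invol] at h3
  -- `rev` and `turn` multiply on the right by generators of `Perm (Fin 3)`. A bijection commuting
  -- with them carries disks to disks and multiplies on the left by a permutation, the required
  -- matching of corners.
  have hξ : ∀ f π, ξ (f, π) = ((ξ (f, 1)).1, (ξ (f, 1)).2 * π) := by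
    intro f
    refine perm_induction ?_ (fun π hπ => ?_) fun π hπ => ?_
    · rw [mul_one]
    · refine (hβ (f, π)).trans ?_
      rw [hπ]
      exact Prod.ext rfl (mul_assoc _ _ _)
    · refine (hγ (f, π)).trans ?_
      rw [hπ]
      exact Prod.ext rfl (mul_assoc _ _ _)
  have hbij : Function.Bijective fun f => (ξ (f, 1)).1 := by
    constructor
    · intro f g hfg
      have : ξ (f, 1) = ξ (g, (ξ (g, 1)).2⁻¹ * (ξ (f, 1)).2) := by
        rw [hξ g]
        exact Prod.ext hfg (by simp)
      exact congrArg Prod.fst (ξ.injective this)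
    · intro f
      refine ⟨(ξ.symm (f, 1)).1, ?_⟩
      have := hξ (ξ.symm (f, 1)).1 (ξ.symm (f, 1)).2
      rw [Prod.mk.eta, ξ.apply_symm_apply] at this
      exact (congrArg Prod.fst this).symm
  refine ⟨Equiv.ofBijective _ hbij, fun f => (ξ (f, 1)).2, ?_⟩
  rintro ⟨f, π⟩ w rfl
  change T.glue ((ξ (f, 1)).1, (ξ (f, 1)).2 * π) = _
  rw [← hξ, ← hα, ← Prod.mk.eta (p := S.glue (f, π)), hξ]
  rfl

end ClosedSManifold

/-! ### The closed s-manifold of a loopless triangular map -/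

namespace TutteMap

open Glue

variable {M : TutteMap}

/-- The flags of the face of a flag `x`, labelled by the permutations of its corners. -/
def faceFlag (x : M.X) (π : Perm (Fin 3)) : M.X :=
  if π = 1 then x else if π = swap 0 1 then M.β x else if π = swap 1 2 then M.γ x
  else if π = swap 0 1 * swap 1 2 then M.γ (M.β x)
  else if π = swap 1 2 * swap 0 1 then M.β (M.γ x) else M.β (M.γ (M.β x))

/-- In a triangular map `β` and `γ` satisfy the braid relation `hc`, which together with their being
involutions presents `Perm (Fin 3)`. -/
theorem faceFlag_mul (ht : M.Triangular) (x : M.X) (π : Perm (Fin 3)) :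
    faceFlag x (π * swap 0 1) = M.β (faceFlag x π) ∧
      faceFlag x (π * swap 1 2) = M.γ (faceFlag x π) := by
  have hc : M.γ (M.β (M.γ x)) = M.β (M.γ (M.β x)) := by
    have := ht.γβ_cube (M.β (M.γ (M.β x)))
    rw [M.β_invol, M.γ_invol, M.β_invol] at this
    exact this
  have hc' : M.γ (M.β (M.γ (M.β x))) = M.β (M.γ x) := by
    rw [← hc, M.γ_invol]
  have e1 : faceFlag x 1 = x := rfl
  have e2 : faceFlag x (swap 0 1) = M.β x := by simp +decide [faceFlag]
  have e3 : faceFlag x (swap 1 2) = M.γ x := by simp +decide [faceFlag]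
  have e4 : faceFlag x (swap 0 1 * swap 1 2) = M.γ (M.β x) := by simp +decide [faceFlag]
  have e5 : faceFlag x (swap 1 2 * swap 0 1) = M.β (M.γ x) := by simp +decide [faceFlag]
  have e6 : faceFlag x (swap 0 1 * swap 1 2 * swap 0 1) = M.β (M.γ (M.β x)) := by
    simp +decide [faceFlag]
  have e7 : (swap 1 2 * swap 0 1 * swap 1 2 : Perm (Fin 3)) = swap 0 1 * swap 1 2 * swap 0 1 := by
    decide
  have e8 : (swap 0 1 * swap 1 2 * swap 0 1 * swap 1 2 : Perm (Fin 3)) = swap 1 2 * swap 0 1 := by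
    decide
  have key : ∀ σ : Perm (Fin 3), σ = 1 ∨ σ = swap 0 1 ∨ σ = swap 1 2 ∨
      σ = swap 0 1 * swap 1 2 ∨ σ = swap 1 2 * swap 0 1 ∨
      σ = swap 0 1 * swap 1 2 * swap 0 1 := by decide
  have hs : ∀ i j : Fin 3, ∀ σ : Perm (Fin 3), σ * swap i j * swap i j = σ := fun i j σ => by
    rw [mul_assoc, swap_mul_self, mul_one]
  rcases key π with rfl | rfl | rfl | rfl | rfl | rfl <;>
    simp only [one_mul, swap_mul_self, hs, e1, e2, e3, e4, e5, e6, e7, e8, M.β_invol, M.γ_invol, hc,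
      hc', and_self]

theorem forall_mem_of_orbitRel {T : Set (Perm M.X)} {S : Set M.X} (hS : ∀ g ∈ T, ∀ x, g x ∈ S ↔ x ∈ S)
    {x y : M.X} (h : MulAction.orbitRel (Subgroup.closure T) M.X x y) (hy : y ∈ S) : x ∈ S := by
  obtain ⟨⟨g, hg⟩, rfl⟩ := h
  have := label_eq_of_mem_closure (v := fun x => x ∈ S) (fun g hg x => propext (hS g hg x)) hg y
  exact this ▸ hy

variable (M) in
/-- The faces of a map. -/
abbrev Face : Type :=
  MulAction.orbitRel.Quotient (Subgroup.closure {M.P * M.α * M.β, M.β}) M.X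

/-- Surjectivity holds because the flags reached from a representative are closed under `β` and `γ`;
injectivity follows by counting six flags per face. -/
theorem faceFlag_bijective (ht : M.Triangular) :
    Function.Bijective fun z : Side M.Face => faceFlag z.1.out z.2 := by
  rw [Nat.bijective_iff_surjective_and_card]
  constructor
  · intro x
    let f : M.Face := Quotient.mk _ x
    have hβ : ∀ y, y ∈ Set.range (faceFlag f.out) → M.β y ∈ Set.range (faceFlag f.out) := by
      rintro _ ⟨π, rfl⟩
      exact ⟨_, (faceFlag_mul ht _ π).1⟩
    have hγ : ∀ y, y ∈ Set.range (faceFlag f.out) → M.γ y ∈ Set.range (faceFlag f.out) := by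
      rintro _ ⟨π, rfl⟩
      exact ⟨_, (faceFlag_mul ht _ π).2⟩
    have hx : x ∈ Set.range (faceFlag f.out) := by
      refine forall_mem_of_orbitRel (T := {M.P * M.α * M.β, M.β}) ?_
        (Quotient.exact (Quotient.out_eq f).symm) ⟨1, rfl⟩
      rintro g (rfl | rfl) y
      · rw [Pαβ_apply]
        exact ⟨fun h => by simpa [M.β_invol, M.γ_invol] using hβ _ (hγ _ h),
          fun h => hγ _ (hβ _ h)⟩
      · exact ⟨fun h => by simpa [M.β_invol] using hβ _ h, hβ y⟩
    obtain ⟨π, hπ⟩ := hx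
    exact ⟨(f, π), hπ⟩
  · rw [← ht.faceCount_mul, Nat.card_prod, Nat.card_perm, Nat.card_fin]
    rfl

/-- The flags of a triangular map as the directed sides of its faces. -/
noncomputable def sideEquiv (ht : M.Triangular) : Side M.Face ≃ M.X :=
  Equiv.ofBijective _ (faceFlag_bijective ht)

section sideEquiv

variable (ht : M.Triangular)

theorem sideEquiv_rev (z : Side M.Face) : sideEquiv ht (rev z) = M.β (sideEquiv ht z) :=
  (faceFlag_mul ht _ z.2).1

theorem sideEquiv_turn (z : Side M.Face) : sideEquiv ht (turn z) = M.γ (sideEquiv ht z) :=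
  (faceFlag_mul ht _ z.2).2

/-- The identification of the directed sides of the faces of a triangular map. -/
noncomputable def mapGlue : Perm (Side M.Face) :=
  ((sideEquiv ht).trans M.α).trans (sideEquiv ht).symm

theorem sideEquiv_mapGlue (z : Side M.Face) :
    sideEquiv ht (mapGlue ht z) = M.α (sideEquiv ht z) := by
  simp [mapGlue]

theorem sideEquiv_turn_mapGlue (z : Side M.Face) :
    sideEquiv ht ((turn * mapGlue ht : Perm (Side M.Face)) z) = M.P (sideEquiv ht z) := by
  rw [Perm.mul_apply, sideEquiv_turn, sideEquiv_mapGlue, P_apply]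

theorem vert_sideEquiv {z w : Side M.Face} (h : w ∈ vertexSides (mapGlue ht) z) :
    M.vert (sideEquiv ht w) = M.vert (sideEquiv ht z) := by
  obtain ⟨g, hg, rfl⟩ := h
  refine label_eq_of_mem_closure (v := fun w => M.vert (sideEquiv ht w)) ?_ hg z
  rintro k (rfl | rfl) y
  · simp only [Perm.mul_apply, sideEquiv_turn, sideEquiv_mapGlue, vert_γ, vert_α]
  · simp only [sideEquiv_mapGlue, vert_α]

/-- In a loopless triangular map the three corners of a face lie at distinct vertices. -/
theorem start_eq_of_vert_eq (hl : M.Loopless) {z w : Side M.Face} (hf : w.1 = z.1)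
    (hv : M.vert (sideEquiv ht w) = M.vert (sideEquiv ht z)) : start w = start z := by
  obtain ⟨f, π⟩ := z
  obtain ⟨g, τ⟩ := w
  obtain rfl : g = f := hf
  -- A side at another corner of the face is one `β` away, up to applications of `γ` before and
  -- after it; `γ` keeps the vertex and `β` leaves it.
  have key : ∀ π τ : Perm (Fin 3), τ 0 = π 0 ∨ τ = π * swap 0 1 ∨ τ = π * swap 0 1 * swap 1 2 ∨
      τ = π * swap 1 2 * swap 0 1 ∨ τ = π * swap 1 2 * swap 0 1 * swap 1 2 := by decide
  have hβ : ∀ π, sideEquiv ht (g, π * swap 0 1) = M.β (sideEquiv ht (g, π)) :=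
    fun π => sideEquiv_rev ht (g, π)
  have hγ : ∀ π, sideEquiv ht (g, π * swap 1 2) = M.γ (sideEquiv ht (g, π)) :=
    fun π => sideEquiv_turn ht (g, π)
  rcases key π τ with h | rfl | rfl | rfl | rfl
  · exact Prod.ext rfl h
  · rw [hβ] at hv
    exact absurd hv (hl.vert_β _)
  · rw [hγ, hβ, vert_γ] at hv
    exact absurd hv (hl.vert_β _)
  · rw [hβ, hγ, ← M.vert_γ (sideEquiv ht (g, π))] at hv
    exact absurd hv (hl.vert_β _)
  · rw [hγ, hβ, hγ, vert_γ, ← M.vert_γ (sideEquiv ht (g, π))] at hv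
    exact absurd hv (hl.vert_β _)

end sideEquiv

/-- The closed s-manifold of a loopless triangular map with valencies five, six and seven. -/
noncomputable def toManifold (ht : M.Triangular) (hl : M.Loopless) (hv : M.valencies ⊆ {5, 6, 7}) :
    ClosedSManifold where
  F := M.Face
  finite := Quotient.finite _
  nonempty := ⟨Quotient.mk _ (Classical.choice M.nonempty)⟩
  glue := mapGlue ht
  glue_invol := fun z => (sideEquiv ht).injective (by
    rw [sideEquiv_mapGlue, sideEquiv_mapGlue, M.α_invol])
  glue_rev := fun z => (sideEquiv ht).injective (by
    rw [sideEquiv_mapGlue, sideEquiv_rev, sideEquiv_rev, sideEquiv_mapGlue, M.α_β_comm])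
  glue_ne := by
    intro z h
    have hs := start_eq_of_vert_eq ht hl h (by rw [sideEquiv_mapGlue, vert_α])
    -- If an edge had one face on both sides, `α` would fix a flag or agree there with `γ`; the
    -- latter means a vertex of valency one.
    rcases eq_or_eq_turn hs with e | e
    · refine M.α_free (sideEquiv ht z) ?_
      rw [← sideEquiv_mapGlue, e]
    · refine γ_ne_α (M := M) (fun h1 => ?_) (sideEquiv ht z) ?_
      · exact absurd (hv h1) (by simp)
      · rw [← sideEquiv_turn, ← e, sideEquiv_mapGlue]
  vertex_distinct := by
    intro f i j h
    rw [← start_swap (f, i), sameVertex_iff] at h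
    obtain ⟨w, hw, hwj⟩ := h
    have h1 := start_eq_of_vert_eq ht hl (z := (f, swap 0 i)) (w := w)
      (show (start w).1 = f by rw [hwj]) (vert_sideEquiv ht hw)
    rw [hwj] at h1
    have h2 : j = i := congrArg Prod.snd (h1.trans (start_swap (f, i)))
    exact h2.symm
  vertex_disks := by
    have hα : ∀ z, mapGlue ht (mapGlue ht z) = z := fun z => (sideEquiv ht).injective (by
      rw [sideEquiv_mapGlue, sideEquiv_mapGlue, M.α_invol])
    have hpow : ∀ (k : ℕ) z, sideEquiv ht ((turn * mapGlue ht : Perm (Side M.Face))^[k] z) =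
        M.P^[k] (sideEquiv ht z) := fun k =>
      (Function.Semiconj.iterate_right (sideEquiv_turn_mapGlue ht) k)
    have hinv : (turn * mapGlue ht)⁻¹ = mapGlue ht * turn := by
      rw [inv_eq_iff_mul_eq_one]
      ext1 z
      change turn (mapGlue ht (mapGlue ht (turn z))) = z
      rw [hα, ClosedSManifold.turn_turn]
    have hQ : mapGlue ht * (turn * mapGlue ht) = (turn * mapGlue ht)⁻¹ * mapGlue ht := by
      rw [hinv, mul_assoc]
    intro c
    rw [← start_swap c]
    have : Finite M.Face := Quotient.finite _
    rw [ncard_sameVertex hα hQ (basic_of_free _ _ hQ (fun z h => ?_) fun z h => ?_)]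
    · refine hv ⟨sideEquiv ht (c.1, swap 0 c.2), ?_⟩
      refine Function.minimalPeriod_eq_minimalPeriod_iff.2 fun n => ?_
      rw [Function.IsPeriodicPt, Function.IsFixedPt, ← hpow, (sideEquiv ht).injective.eq_iff]
      rfl
    · exact M.α_free _ ((sideEquiv_mapGlue ht z).symm.trans (congrArg _ h))
    · rw [Perm.mul_apply, hα] at h
      exact ClosedSManifold.turn_ne z h
  connected := by
    intro f g
    have hside : ∀ x : M.X, ∀ z : Side M.Face, z.1 = ((sideEquiv ht).symm x).1 →
        Linked (mapGlue ht) f z.1 → Linked (mapGlue ht) f ((sideEquiv ht).symm x).1 :=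
      fun x z h h' => h ▸ h'
    have h := M.forall_mem (S := {x | Linked (mapGlue ht) f ((sideEquiv ht).symm x).1})
      (x₀ := sideEquiv ht (f, 1)) ?_ ?_ ?_ ?_ (sideEquiv ht (g, 1))
    · simpa using h
    · rw [Set.mem_ofPred_eq, symm_apply_apply]
      exact Relation.EqvGen.refl _
    · intro x hx
      obtain ⟨z, rfl⟩ := (sideEquiv ht).surjective x
      simp only [Set.mem_ofPred_eq, symm_apply_apply] at hx ⊢
      rw [← sideEquiv_mapGlue, symm_apply_apply]
      exact hx.trans _ _ _ (Relation.EqvGen.rel _ _ ⟨z, rfl, rfl⟩)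
    · intro x hx
      obtain ⟨z, rfl⟩ := (sideEquiv ht).surjective x
      simp only [Set.mem_ofPred_eq, symm_apply_apply] at hx ⊢
      rwa [← sideEquiv_rev, symm_apply_apply]
    · intro x hx
      obtain ⟨z, rfl⟩ := (sideEquiv ht).surjective x
      simp only [Set.mem_ofPred_eq, symm_apply_apply] at hx ⊢
      rwa [← sideEquiv_turn, symm_apply_apply]

theorem toMap_toManifold_iso (ht : M.Triangular) (hl : M.Loopless) (hv : M.valencies ⊆ {5, 6, 7}) :
    (toManifold ht hl hv).toMap.Iso M :=
  iso_of_commute (M := (toManifold ht hl hv).toMap) (sideEquiv ht) (sideEquiv_mapGlue ht)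
    (sideEquiv_rev ht)
    fun z => (congrArg (sideEquiv ht) ((toManifold ht hl hv).toMap_γ z)).trans (sideEquiv_turn ht z)

end TutteMap

/-- Closed s-manifolds with `n` disks correspond to loopless triangular maps with `n` faces and
valencies five, six and seven. -/
theorem bijOn_classToMap (n : ℕ) : Set.BijOn ClosedSManifold.classToMap
    ((fun S => (⟦S⟧ : ClosedSManifold.Class)) '' {S | Nat.card S.F = n})
    (TutteMap.classesOf {M | M.Loopless ∧ M.Triangular ∧ M.valencies ⊆ {5, 6, 7} ∧
      M.faceCount = n}) := by
  refine ⟨?_, ?_, ?_⟩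
  · rintro _ ⟨S, hS, rfl⟩
    exact ⟨S.toMap, ⟨S.loopless_toMap, S.triangular_toMap, S.valencies_toMap,
      S.faceCount_toMap.trans hS⟩, rfl⟩
  · rintro _ ⟨S, -, rfl⟩ _ ⟨T, -, rfl⟩ h
    exact Quotient.sound (ClosedSManifold.iso_of_toMap_iso (Quotient.exact h))
  · rintro _ ⟨M, ⟨hl, ht, hv, hn⟩, rfl⟩
    exact ⟨_, ⟨TutteMap.toManifold ht hl hv, hn, rfl⟩,
      Quotient.sound (TutteMap.toMap_toManifold_iso ht hl hv)⟩

/-! ### The classification -/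

namespace TutteMap

theorem mem_classesOf {S : Set TutteMap} {M : TutteMap} (h : M ∈ S) : (⟦M⟧ : Class) ∈ classesOf S :=
  ⟨M, h, rfl⟩

/-- The three permutations of a map, transported to `Fin n`. -/
noncomputable def transport (M : TutteMap) :
    Σ n : ℕ, Perm (Fin n) × Perm (Fin n) × Perm (Fin n) :=
  ⟨Nat.card M.X, (Finite.equivFin M.X).permCongr M.α, (Finite.equivFin M.X).permCongr M.β,
    (Finite.equivFin M.X).permCongr M.P⟩

theorem iso_of_transport_eq {M N : TutteMap} (h : M.transport = N.transport) : M.Iso N := by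
  have key : ∀ {m n : ℕ} (e : M.X ≃ Fin m) (f : N.X ≃ Fin n),
      (⟨m, e.permCongr M.α, e.permCongr M.β, e.permCongr M.P⟩ :
        Σ n : ℕ, Perm (Fin n) × Perm (Fin n) × Perm (Fin n)) =
      ⟨n, f.permCongr N.α, f.permCongr N.β, f.permCongr N.P⟩ → M.Iso N := by
    intro m n e f h
    obtain rfl : m = n := congrArg Sigma.fst h
    obtain ⟨h1, h2⟩ := Prod.mk.inj (eq_of_heq (Sigma.mk.inj h).2)
    obtain ⟨h2, h3⟩ := Prod.mk.inj h2
    have conj : ∀ {p : Perm M.X} {q : Perm N.X}, e.permCongr p = f.permCongr q →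
        ∀ x, f.symm (e (p x)) = q (f.symm (e x)) := by
      intro p q h x
      have := Perm.congr_fun h (e x)
      simp only [permCongr_apply, symm_apply_apply] at this
      rw [this, symm_apply_apply]
    exact ⟨e.trans f.symm, fun x => ⟨conj h1 x, conj h2 x, conj h3 x⟩⟩
  exact key _ _ h

/-- Finite maps are encoded by triples of permutations of some `Fin n`. Countability lets an
infinite `Delta` be written as a sequence without repetitions. -/
instance : Countable Class :=
  Function.Injective.countable (f := fun q : Class => q.out.transport) fun q r h => by
    rw [← Quotient.out_eq q, ← Quotient.out_eq r]
    exact Quotient.sound (iso_of_transport_eq h)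

/-- An infinite set of isomorphism classes can be enumerated without repetitions. -/
theorem exists_enumeration {S : Set Class} (hS : S.Infinite) :
    ∃ f : ℕ → Class, Function.Injective f ∧ Set.range f = S := by
  have := hS.to_subtype
  obtain ⟨e⟩ := nonempty_equiv_of_countable (α := ℕ) (β := S)
  refine ⟨fun n => e n, Subtype.val_injective.comp e.injective, ?_⟩
  rw [Set.range_comp' Subtype.val e, e.surjective.range_eq, Set.image_univ, Subtype.range_coe]

/-! ### The sets `Delta C V` for a collection `C` containing all loopless maps -/

section Delta

variable {C : Set TutteMap}

/-- Keeping track of orientability allows the same family to serve for the torus and the Klein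
bottle. A vertex of valency one is excluded because subdivision would create a loop there. -/
theorem infinite_classesOf_subdiv (hC : ∀ M : TutteMap, M.Loopless → M ∈ C)
    {V : Set ℕ} {M : TutteMap} (hl : M.Loopless) (ht : M.Triangular)
    (hv : M.valencies = V) (h1 : 1 ∉ V) : (classesOf {N | N ∈ C ∧ N.Triangular ∧
      N.valencies = V ∪ {6} ∧ (N.Nonorientable ↔ M.Nonorientable)}).Infinite := by
  refine Set.infinite_of_injective_forall_mem
    (f := fun k : ℕ => (⟦subdiv^[k + 1] M⟧ : Class)) ?_ fun k => ?_
  · exact (class_subdiv_iterate_injective M).comp (add_left_injective 1)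
  · obtain ⟨i1, i2, i3, i4⟩ := subdiv_iterate hl ht hv h1 k
    exact mem_classesOf ⟨hC _ i1, i2, i3, i4⟩

theorem infinite_delta_subdiv (hC : ∀ M : TutteMap, M.Loopless → M ∈ C)
    {V : Set ℕ} {M : TutteMap} (hl : M.Loopless) (ht : M.Triangular)
    (hv : M.valencies = V) (h1 : 1 ∉ V) : (Delta C (V ∪ {6})).Infinite := by
  refine (infinite_classesOf_subdiv hC hl ht hv h1).mono ?_
  rintro _ ⟨N, ⟨h1, h2, h3, -⟩, rfl⟩
  exact mem_classesOf ⟨h1, h2, h3⟩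

theorem delta_five (hC : ∀ M : TutteMap, M.Loopless → M ∈ C) :
    Delta C {5} = {⟦O20⟧, ⟦P10⟧} := by
  ext q
  constructor
  · rintro ⟨M, ⟨-, ht, h5⟩, rfl⟩
    rcases Pentavalent.iso_or_iso ht h5 O20_triangular O20_valencies P10_triangular P10_valencies
      O20_not_iso_P10 with h | h
    · exact Or.inl (Quotient.sound h)
    · exact Or.inr (Quotient.sound h)
  · rintro (rfl | rfl)
    · exact mem_classesOf ⟨hC _ O20_loopless, O20_triangular, O20_valencies⟩
    · exact mem_classesOf ⟨hC _ P10_loopless, P10_triangular, P10_valencies⟩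

theorem delta_six (hC : ∀ M : TutteMap, M.Loopless → M ∈ C) :
    ∃ T K : ℕ → Class, Function.Injective T ∧ Function.Injective K ∧
    (∀ i, T i ∈ classesOf {M | M.OnTorus}) ∧ (∀ j, K j ∈ classesOf {M | M.OnKleinBottle}) ∧
    Delta C {6} = Set.range T ∪ Set.range K := by
  set A := classesOf {M | (M ∈ C ∧ M.Triangular ∧ M.valencies = {6}) ∧ M.OnTorus} with hA
  set B := classesOf {M | (M ∈ C ∧ M.Triangular ∧ M.valencies = {6}) ∧ M.OnKleinBottle} with hB
  have hAinf : A.Infinite := by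
    refine (infinite_classesOf_subdiv hC torusFlags_loopless torusFlags_triangular
      torusFlags_valencies (by simp)).mono ?_
    rintro _ ⟨N, ⟨h1, h2, h3, h4⟩, rfl⟩
    rw [Set.union_self] at h3
    exact mem_classesOf ⟨⟨h1, h2, h3⟩, fun h => torusFlags_orientable (h4.1 h),
      eulerChar_eq_zero h2 h3⟩
  have hBinf : B.Infinite := by
    refine (infinite_classesOf_subdiv hC kleinFlags_loopless kleinFlags_triangular
      kleinFlags_valencies (by simp)).mono ?_
    rintro _ ⟨N, ⟨h1, h2, h3, h4⟩, rfl⟩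
    rw [Set.union_self] at h3
    exact mem_classesOf ⟨⟨h1, h2, h3⟩, h4.2 kleinFlags_nonorientable, eulerChar_eq_zero h2 h3⟩
  obtain ⟨T, hT, hTA⟩ := exists_enumeration hAinf
  obtain ⟨K, hK, hKB⟩ := exists_enumeration hBinf
  refine ⟨T, K, hT, hK, fun i => ?_, fun j => ?_, ?_⟩
  · obtain ⟨M, hM, e⟩ : T i ∈ A := hTA ▸ ⟨i, rfl⟩
    exact ⟨M, hM.2, e⟩
  · obtain ⟨M, hM, e⟩ : K j ∈ B := hKB ▸ ⟨j, rfl⟩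
    exact ⟨M, hM.2, e⟩
  · rw [hTA, hKB]
    ext q
    constructor
    -- Euler characteristic 0 is automatic, so orientability alone separates the two surfaces.
    · rintro ⟨M, hM, rfl⟩
      have h0 := eulerChar_eq_zero hM.2.1 hM.2.2
      by_cases h : M.Nonorientable
      · exact Or.inr (mem_classesOf ⟨hM, h, h0⟩)
      · exact Or.inl (mem_classesOf ⟨hM, h, h0⟩)
    · rintro (⟨M, hM, rfl⟩ | ⟨M, hM, rfl⟩) <;> exact mem_classesOf hM.1

theorem delta_seven (hC : ∀ M : TutteMap, M.Loopless → M ∈ C) :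
    ∃ H : ℕ → Class, Function.Injective H ∧ Delta C {7} = Set.range H := by
  have hinf : (Delta C {7}).Infinite := by
    refine Set.infinite_of_injective_forall_mem hurwitzCocycle.class_cover_injective fun k => ?_
    refine mem_classesOf ⟨hC _ (hurwitzCocycle.cover_loopless _ hurwitzFlags_loopless),
      hurwitzCocycle.cover_triangular _ hurwitzFlags_triangular, ?_⟩
    rw [Cocycle.valencies_cover, hurwitzFlags_valencies]
  obtain ⟨H, hH, e⟩ := exists_enumeration hinf
  exact ⟨H, hH, e.symm⟩

theorem two_le_delta_five_seven (hC : ∀ M : TutteMap, M.Loopless → M ∈ C) :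
    2 ≤ (Delta C {5, 7}).encard := by
  have hne : (⟦small57Flags.toMap⟧ : Class) ≠ ⟦large57Flags.toMap⟧ := by
    intro h
    have h2 : Nat.card (Fin 48) = Nat.card (Fin 72) := (Quotient.exact h : Iso _ _).card_eq
    simp at h2
  rw [← Set.encard_pair hne]
  refine Set.encard_le_encard ?_
  rintro _ (rfl | rfl)
  · exact mem_classesOf ⟨hC _ small57Flags_loopless, small57Flags_triangular,
      small57Flags_valencies⟩
  · exact mem_classesOf ⟨hC _ large57Flags_loopless, large57Flags_triangular,
      large57Flags_valencies⟩

end Delta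

end TutteMap

/-- First part: closed s-manifolds with `n` triangles correspond to loopless triangular maps with
`n` faces and valencies in `{5, 6, 7}`. Second part: the classification, both for all triangular
maps and for the loopless ones. -/
theorem theorem4p4p1 :
    (∀ n : ℕ, Set.BijOn ClosedSManifold.classToMap
      ((fun S => (⟦S⟧ : ClosedSManifold.Class)) '' {S | Nat.card S.F = n})
      (TutteMap.classesOf {M | M.Loopless ∧ M.Triangular ∧ M.valencies ⊆ {5, 6, 7} ∧
        M.faceCount = n})) ∧
    ∀ C ∈ ({Set.univ, {M | M.Loopless}} : Set (Set TutteMap)),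
      (TutteMap.Delta C {5} = {⟦O20⟧, ⟦P10⟧} ∧ (⟦O20⟧ : TutteMap.Class) ≠ ⟦P10⟧) ∧
      (∃ T K : ℕ → TutteMap.Class, Function.Injective T ∧ Function.Injective K ∧
        (∀ i, T i ∈ TutteMap.classesOf {M | M.OnTorus}) ∧
        (∀ j, K j ∈ TutteMap.classesOf {M | M.OnKleinBottle}) ∧
        TutteMap.Delta C {6} = Set.range T ∪ Set.range K) ∧
      (∃ H : ℕ → TutteMap.Class, Function.Injective H ∧
        TutteMap.Delta C {7} = Set.range H) ∧
      2 ≤ (TutteMap.Delta C {5, 7}).encard ∧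
      (TutteMap.Delta C {5, 6}).Infinite ∧
      (TutteMap.Delta C {6, 7}).Infinite ∧
      (TutteMap.Delta C {5, 6, 7}).Infinite := by
  refine ⟨bijOn_classToMap, fun C hC => ?_⟩
  have hC : ∀ M : TutteMap, M.Loopless → M ∈ C := by
    rcases hC with rfl | rfl
    · exact fun _ _ => trivial
    · exact fun _ h => h
  refine ⟨⟨TutteMap.delta_five hC, fun h => O20_not_iso_P10 (Quotient.exact h)⟩,
    TutteMap.delta_six hC, TutteMap.delta_seven hC, TutteMap.two_le_delta_five_seven hC, ?_, ?_, ?_⟩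
  -- Each seed has exactly the valencies other than 6: the icosahedron, the Hurwitz map and the map
  -- with eight triangles.
  · have := TutteMap.infinite_delta_subdiv hC O20_loopless O20_triangular O20_valencies (by simp)
    rwa [Set.singleton_union] at this
  · have := TutteMap.infinite_delta_subdiv hC
      hurwitzFlags_loopless hurwitzFlags_triangular hurwitzFlags_valencies (by simp)
    rwa [Set.union_comm] at this
  · have := TutteMap.infinite_delta_subdiv hC small57Flags_loopless small57Flags_triangular
      small57Flags_valencies (by simp)
    have e : ({5, 6, 7} : Set ℕ) = {5, 7} ∪ {6} := by
      ext
      simp only [Set.mem_insert_iff, Set.mem_singleton_iff, Set.union_singleton]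
      tauto
    rwa [e]
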